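/- Let $n \ge 1$, $0 \le i \le n$ and $\lambda \in \mathbb{C}$. Identify the space $\mathcal{E}^i(\mathbb{R}^n)$ of smooth complex-valued differential $i$-forms on $\mathbb{R}^n$ with $C^\infty(\mathbb{R}^n) \otimes \bigwedge^i(\mathbb{C}^n)$ by $f\,dx_{k_1}\wedge\dots\wedge dx_{k_i} \leftrightarrow f \otimes e_{k_1}\wedge\dots\wedge e_{k_i}$, and let $\mathcal{E}^i_c(\mathbb{R}^n)$ be the subspace of compactly supported forms. For $x \in \mathbb{R}^n \setminus \{0\}$ let $\psi_n(x) = I_n - \frac{2\,x\,{}^t x}{|x|^2} \in O(n)$, let $\sigma^{(i)} \colon O(n) \to GL_{\mathbb{C}}(\bigwedge^i(\mathbb{C}^n))$ be the $i$-th exterior power of the natural representation, and put $$\widetilde{\mathcal{T}}^{(i)}_\lambda(x) = \frac{1}{\Gamma(\lambda - \frac n2)}\,|x|^{2(\lambda - n)}\,\sigma^{(i)}(\psi_n(x)) .$$ For $\operatorname{Re}\lambda > \frac n2$ this is a locally integrable $\operatorname{End}_{\mathbb{C}}(\bigwedge^i(\mathbb{C}^n))$-valued function on $\mathbb{R}^n$,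 and the convolution map $\mathcal{E}^i_c(\mathbb{R}^n) \to \mathcal{E}^i(\mathbb{R}^n)$, $f \mapsto \widetilde{\mathcal{T}}^{(i)}_\lambda * f$, has an analytic continuation in $\lambda$ to all of $\mathbb{C}$ (for all $f$ and $x$, the value at $x$ of the image of $f$ continues to an entire function of $\lambda$, and for every $\lambda$ the resulting form is smooth). Write $\widetilde{\mathbb{T}}^{(i)}_{\lambda, n-\lambda} \colon \mathcal{E}^i_c(\mathbb{R}^n) \to \mathcal{E}^i(\mathbb{R}^n)$ for the continued operator (the normalized Knapp--Stein intertwining operator in the $N$-picture). Let $d$ be the exterior derivative, $d^*$ its formal adjoint (for the Euclidean metric), $\Delta = -(d d^* + d^* d)$, and for $l \in \mathbb{N}_+ = \{1,2,\dots\}$ let $$\mathcal{D}^{(i)}_{2l} = -\left(\tfrac n2 - i\right)\Delta^l + l\,(d^* d - d d^*)\,\Delta^{l-1}$$ be Branson's conformally covariant operator on $i$-forms. 1. For every $\lambda \in \mathbb{C}$, the operator $\widetilde{\mathbb{T}}^{(i)}_{\lambda, n-\lambda}$ is a differential operator (of finite order, with smooth $\operatorname{End}_{\mathbb{C}}(\bigwedge^i(\mathbb{C}^n))$-valued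 coefficients) if and only if $n - 2\lambda \in 2\mathbb{N} = \{0, 2, 4, \dots\}$. 2. For every $l \in \mathbb{N}_+$, on $\mathcal{E}^i_c(\mathbb{R}^n)$, $$\widetilde{\mathbb{T}}^{(i)}_{\lambda, n-\lambda}\Big|_{\lambda = \frac n2 - l} = \frac{(-1)^{l+1}\,\pi^{\frac n2}}{2^{2l}\,\Gamma(\frac n2 + l + 1)}\;\mathcal{D}^{(i)}_{2l} .$$ -/

import Mathlib

open MeasureTheory Set
open scoped ContDiff RealInnerProductSpace

noncomputable section

namespace KnappStein

/-- Euclidean space `ℝⁿ`. -/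
abbrev E (n : ℕ) : Type := EuclideanSpace ℝ (Fin n)

/-- `ek k` is the `k`-th standard basis vector of `ℝⁿ`. -/
abbrev ek {n : ℕ} (k : Fin n) : E n := EuclideanSpace.single k (1 : ℝ)

/-- Alternating `i`-forms on `V` with values in `F`. -/
abbrev AltForm (V F : Type) [NormedAddCommGroup V] [NormedSpace ℝ V]
    [NormedAddCommGroup F] [NormedSpace ℝ F] (i : ℕ) : Type :=
  V [⋀^Fin i]→L[ℝ] F

/-- The fibre `⋀ⁱ(ℂⁿ)` of complex-valued `i`-forms, realised as the space of alternating
`ℝ`-multilinear maps `(ℝⁿ)ⁱ → ℂ`, the basis vector `e_I` of `⋀ⁱ(ℂⁿ)` being identified with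
`dx_I = dx_{k₁} ∧ ⋯ ∧ dx_{kᵢ}`. -/
abbrev Form (n i : ℕ) : Type := AltForm (E n) ℂ i

/-- `f ∈ 𝓔ᵢ_c(ℝⁿ)`: a smooth, compactly supported differential `i`-form. -/
def IsTestForm {n i : ℕ} (f : E n → Form n i) : Prop :=
  ContDiff ℝ ∞ f ∧ HasCompactSupport f

/-! ### The kernel of the Knapp--Stein operator -/

/-- `ψ(x) ∈ O(n)`, the reflection in the hyperplane orthogonal to `x`. -/
def psi {n : ℕ} (x : E n) : E n ≃ₗᵢ[ℝ] E n := (ℝ ∙ x)ᗮ.reflection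

/-- As a matrix, `ψ(x) = Iₙ - 2 x ᵗx / |x|²`. -/
theorem psi_apply {n : ℕ} (x v : E n) :
    psi x v = v - (2 * ⟪x, v⟫ / ‖x‖ ^ 2) • x := by
  rw [psi, Submodule.reflection_orthogonal_apply, Submodule.reflection_singleton_apply]
  simp only [RCLike.ofReal_real_eq_id, id_eq, neg_sub, two_smul]
  rw [← add_smul]
  congr 2
  ring

/-- `σ⁽ⁱ⁾ : O(n) → GL(⋀ⁱ(ℂⁿ))`, the `i`-th exterior power of the natural representation.
On forms the action of `A` is `u ↦ u(A⁻¹ ·, …, A⁻¹ ·)`; since `A` is orthogonal this sends `dx_k`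
to `∑ⱼ Aⱼₖ dx_j`, as the natural representation sends `e_k` to `∑ⱼ Aⱼₖ e_j`. -/
def sigma {n : ℕ} (i : ℕ) (A : E n ≃ₗᵢ[ℝ] E n) : Form n i →ₗ[ℂ] Form n i where
  toFun u := u.compContinuousLinearMap (A.symm.toContinuousLinearEquiv : E n →L[ℝ] E n)
  map_add' _ _ := rfl
  map_smul' _ _ := rfl

/-- The normalised `End(⋀ⁱ(ℂⁿ))`-valued kernel
`Γ(λ - n/2)⁻¹ |x|^{2(λ-n)} σ⁽ⁱ⁾(ψ(x))`. -/
def kernel (n i : ℕ) (lam : ℂ) (x : E n) : Form n i →ₗ[ℂ] Form n i :=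
  ((Complex.Gamma (lam - n / 2))⁻¹ * ((‖x‖ : ℝ) : ℂ) ^ (2 * (lam - n))) • sigma i (psi x)

/-- The convolution `kernel * f`. -/
def convKernel (n i : ℕ) (lam : ℂ) (f : E n → Form n i) (x : E n) : Form n i :=
  ∫ y, kernel n i lam (x - y) (f y)

/-- The half plane `Re λ > n/2`, in which the kernel is locally integrable. -/
def convHalfPlane (n : ℕ) : Set ℂ := {lam | (n : ℝ) / 2 < lam.re}

open Classical in
/-- The analytic continuation to the whole plane `ℂ` of a function `F` given on `U`, if there is
one (and `0` if there is none). -/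
def entireContinuation {V : Type*} [NormedAddCommGroup V] [NormedSpace ℂ V]
    (U : Set ℂ) (F : ℂ → V) : ℂ → V :=
  if h : ∃ G : ℂ → V, Differentiable ℂ G ∧ EqOn G F U then h.choose else fun _ => 0

/-- The analytic continuation from a nonempty open set is unique. -/
theorem entireContinuation_eq {V : Type*} [NormedAddCommGroup V] [NormedSpace ℂ V]
    [CompleteSpace V] {U : Set ℂ} (hU : IsOpen U) (hne : U.Nonempty) {F G : ℂ → V}
    (hG : Differentiable ℂ G) (hGF : EqOn G F U) : entireContinuation U F = G := by
  have h : ∃ G : ℂ → V, Differentiable ℂ G ∧ EqOn G F U := ⟨G, hG, hGF⟩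
  rw [entireContinuation, dif_pos h]
  obtain ⟨z, hz⟩ := hne
  have h1 : AnalyticOnNhd ℂ h.choose univ := fun w _ => h.choose_spec.1.analyticAt w
  have h2 : AnalyticOnNhd ℂ G univ := fun w _ => hG.analyticAt w
  refine h1.eq_of_eventuallyEq h2 (z₀ := z) ?_
  filter_upwards [hU.mem_nhds hz] with w hw
  rw [h.choose_spec.2 hw, hGF hw]

/-- The normalised Knapp--Stein operator `𝓔ᵢ_c(ℝⁿ) → 𝓔ᵢ(ℝⁿ)` with parameter `λ ∈ ℂ`: the analytic
continuation in `λ` of the convolution with `kernel n i λ`. -/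
def knappStein (n i : ℕ) (lam : ℂ) (f : E n → Form n i) (x : E n) : Form n i :=
  entireContinuation (convHalfPlane n) (fun mu => convKernel n i mu f x) lam

/-! ### Differential operators -/

/-- `T`, defined on smooth compactly supported `i`-forms, is a (linear) differential operator:
there are an order `N` and smooth `End(⋀ⁱ(ℂⁿ))`-valued coefficients `a_{k,w}` (smooth on every
vector of the finite-dimensional space `⋀ⁱ(ℂⁿ)`) with
`T f = ∑_{k ≤ N} ∑_w a_{k,w} ∂_{w₁} ⋯ ∂_{w_k} f`, where `w` runs through the words of length `k`
in `1, …, n`. -/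
def IsDifferentialOperator {n i : ℕ} (T : (E n → Form n i) → (E n → Form n i)) : Prop :=
  ∃ (N : ℕ) (a : (k : ℕ) → (Fin k → Fin n) → E n → (Form n i →ₗ[ℂ] Form n i)),
    (∀ k w v, ContDiff ℝ ∞ (fun x => a k w x v)) ∧
    ∀ f : E n → Form n i, IsTestForm f → ∀ x : E n,
      T f x = ∑ k ∈ Finset.range (N + 1), ∑ w : Fin k → Fin n,
        a k w x (iteratedFDeriv ℝ k f x (fun j => ek (w j)))

/-! ### Branson's operator -/

/-- The codifferential `d* = - ∑ₖ ι_{∂/∂xₖ} ∂/∂xₖ` on Euclidean space, the formal adjoint of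
the exterior derivative (see `integral_formInner_extDeriv`). -/
def codiff {n i : ℕ} (u : E n → Form n (i + 1)) (x : E n) : Form n i :=
  -∑ k : Fin n, (fderiv ℝ u x (ek k)).curryLeft (ek k)

/-- `d* d` on `i`-forms. -/
def codiffD {n i : ℕ} (u : E n → Form n i) : E n → Form n i := codiff (extDeriv u)

/-- `d d*` on `i`-forms (`d* = 0` on functions). -/
def dCodiff {n : ℕ} : {i : ℕ} → (E n → Form n i) → E n → Form n i
  | 0, _ => 0
  | _ + 1, u => extDeriv (codiff u)

/-- The Laplace--Beltrami operator `Δ = -(d d* + d* d)` on `i`-forms. -/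
def laplace {n i : ℕ} (u : E n → Form n i) : E n → Form n i :=
  -(dCodiff u + codiffD u)

/-- Branson's conformally covariant operator `𝓓_{2l}⁽ⁱ⁾` on `i`-forms:
`-(n/2 - i) Δˡ + l (d* d - d d*) Δˡ⁻¹` for `l ≥ 1`, and `-(n/2 - i) id` for `l = 0`. -/
def branson {n i : ℕ} : ℕ → (E n → Form n i) → E n → Form n i
  | 0, u => (-((n : ℂ) / 2 - i)) • u
  | l + 1, u => (-((n : ℂ) / 2 - i)) • laplace^[l + 1] u
      + ((l + 1 : ℕ) : ℂ) • (codiffD (laplace^[l] u) - dCodiff (laplace^[l] u))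

/-- The pointwise Hermitian inner product of `i`-forms, for which the `dx_I` are orthonormal. -/
def formInner {n i : ℕ} (u η : Form n i) : ℂ :=
  ((i.factorial : ℂ))⁻¹ * ∑ w : Fin i → Fin n,
    u (fun j => ek (w j)) * (starRingEnd ℂ) (η (fun j => ek (w j)))

theorem formInner_alternatize {n i : ℕ} (D : E n →L[ℝ] Form n i) (b : Form n (i + 1)) :
    formInner (ContinuousAlternatingMap.alternatizeUncurryFin D) b =
      ((i.factorial : ℂ))⁻¹ * ∑ k : Fin n, ∑ w : Fin i → Fin n,
        D (ek k) (fun j => ek (w j)) *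
          (starRingEnd ℂ) (b.curryLeft (ek k) (fun j => ek (w j))) := by
  have key : ∀ p : Fin (i + 1), ∑ w : Fin (i + 1) → Fin n,
      ((-1) ^ (p : ℕ) • D (ek (w p)) (p.removeNth (fun j => ek (w j)))) *
        (starRingEnd ℂ) (b (fun j => ek (w j))) =
      ∑ k : Fin n, ∑ w : Fin i → Fin n, D (ek k) (fun j => ek (w j)) *
          (starRingEnd ℂ) (b.curryLeft (ek k) (fun j => ek (w j))) := by
    intro p
    rw [← Fintype.sum_prod_type', ← (Fin.insertNthEquiv (fun _ => Fin n) p).sum_comp]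
    refine Finset.sum_congr rfl fun q _ => ?_
    obtain ⟨k, w⟩ := q
    have h1 : (fun j => (ek (p.insertNth (α := fun _ => Fin n) k w j) : E n)) =
        p.insertNth (α := fun _ => E n) (ek k) (fun j => ek (w j)) := by
      ext1 j
      refine Fin.succAboveCases p ?_ (fun j => ?_) j <;> simp
    have h2 := b.toAlternatingMap.map_insertNth p (ek k) (fun j => ek (w j))
    simp only [Fin.insertNthEquiv_apply]
    have h3 : b (p.insertNth (α := fun _ => E n) (ek k) (fun j => ek (w j))) =
      (-1) ^ (p : ℕ) • b.curryLeft (ek k) (fun j => ek (w j)) := h2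
    rw [h1, h3]
    simp only [Fin.insertNth_apply_same, Fin.removeNth_insertNth]
    rcases neg_one_pow_eq_or ℤ (p : ℕ) with h | h <;> simp [h]
  rw [formInner]
  simp only [ContinuousAlternatingMap.alternatizeUncurryFin_apply, Finset.sum_mul]
  rw [Finset.sum_comm]
  rw [Finset.sum_congr rfl fun p _ => key p]
  rw [Finset.sum_const, Finset.card_univ, Fintype.card_fin, nsmul_eq_mul, ← mul_assoc,
    Nat.factorial_succ]
  congr 1
  have : ((i : ℂ) + 1) ≠ 0 := by exact_mod_cast Nat.succ_ne_zero i
  have h2 : (i.factorial : ℂ) ≠ 0 := by exact_mod_cast Nat.factorial_ne_zero i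
  push_cast
  field_simp

/-- `d*` is the formal adjoint of `d`: `∫ ⟨d a, b⟩ = ∫ ⟨a, d* b⟩`. -/
theorem integral_formInner_extDeriv {n i : ℕ} (a : E n → Form n i) (b : E n → Form n (i + 1))
    (ha : IsTestForm a) (hb : ContDiff ℝ ∞ b) :
    ∫ x, formInner (extDeriv a x) (b x) = ∫ x, formInner (a x) (codiff b x) := by
  obtain ⟨ha, hac⟩ := ha
  set A : (Fin i → Fin n) → E n → ℂ := fun w x => a x (fun j => ek (w j)) with hA
  set B : Fin n → (Fin i → Fin n) → E n → ℂ := fun k w x =>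
    (starRingEnd ℂ) ((b x).curryLeft (ek k) (fun j => ek (w j))) with hB
  have hda : ∀ x, DifferentiableAt ℝ a x := fun x => (ha.differentiable (by simp)).differentiableAt
  have hdb : ∀ x, DifferentiableAt ℝ b x := fun x => (hb.differentiable (by simp)).differentiableAt
  have hA' : ∀ w x, HasFDerivAt (A w)
      ((ContinuousAlternatingMap.apply ℝ (E n) ℂ (fun j => ek (w j))).comp (fderiv ℝ a x)) x :=
    fun w x => (ContinuousAlternatingMap.apply ℝ (E n) ℂ (fun j => ek (w j))).hasFDerivAt.comp x
      (hda x).hasFDerivAt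
  have hB' : ∀ k w x, HasFDerivAt (B k w)
      ((Complex.conjCLE : ℂ →L[ℝ] ℂ).comp ((ContinuousAlternatingMap.apply ℝ (E n) ℂ
        (Matrix.vecCons (ek k) (fun j => ek (w j)))).comp (fderiv ℝ b x))) x :=
    fun k w x => (Complex.conjCLE : ℂ →L[ℝ] ℂ).hasFDerivAt.comp x
      ((ContinuousAlternatingMap.apply ℝ (E n) ℂ
        (Matrix.vecCons (ek k) (fun j => ek (w j)))).hasFDerivAt.comp x (hdb x).hasFDerivAt)
  have hAc : ∀ w, ContDiff ℝ ∞ (A w) := fun w =>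
    (ContinuousAlternatingMap.apply ℝ (E n) ℂ (fun j => ek (w j))).contDiff.comp ha
  have hBc : ∀ k w, ContDiff ℝ ∞ (B k w) := fun k w =>
    (Complex.conjCLE : ℂ →L[ℝ] ℂ).contDiff.comp ((ContinuousAlternatingMap.apply ℝ (E n) ℂ
        (Matrix.vecCons (ek k) (fun j => ek (w j)))).contDiff.comp hb)
  have hAs : ∀ w, HasCompactSupport (A w) := fun w =>
    hac.comp_left (g := fun u : Form n i => u (fun j => ek (w j))) rfl
  have hA1 : ∀ w k, Continuous (fun x => fderiv ℝ (A w) x (ek k)) := fun w k =>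
    ((hAc w).continuous_fderiv (by simp)).clm_apply continuous_const
  have hB1 : ∀ k w, Continuous (fun x => fderiv ℝ (B k w) x (ek k)) := fun k w =>
    ((hBc k w).continuous_fderiv (by simp)).clm_apply continuous_const
  have hAs1 : ∀ w k, HasCompactSupport (fun x => fderiv ℝ (A w) x (ek k)) := fun w k =>
    (hAs w).fderiv_apply (𝕜 := ℝ) (ek k)
  have I1 : ∀ k w, Integrable (fun x => fderiv ℝ (A w) x (ek k) * B k w x) := fun k w =>
    ((hA1 w k).mul (hBc k w).continuous).integrable_of_hasCompactSupport (hAs1 w k).mul_right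
  have I2 : ∀ k w, Integrable (fun x => A w x * fderiv ℝ (B k w) x (ek k)) := fun k w =>
    ((hAc w).continuous.mul (hB1 k w)).integrable_of_hasCompactSupport (hAs w).mul_right
  have I3 : ∀ k w, Integrable (fun x => A w x * B k w x) := fun k w =>
    ((hAc w).continuous.mul (hBc k w).continuous).integrable_of_hasCompactSupport
      (hAs w).mul_right
  have N2 : ∀ k w, Integrable (fun x => -(A w x * fderiv ℝ (B k w) x (ek k))) := fun k w =>
    (I2 k w).neg
  have parts : ∀ k w, ∫ x, fderiv ℝ (A w) x (ek k) * B k w x =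
      ∫ x, -(A w x * fderiv ℝ (B k w) x (ek k)) := fun k w => by
    rw [integral_neg, integral_mul_fderiv_eq_neg_fderiv_mul_of_integrable (I1 k w) (I2 k w)
      (I3 k w) (fun x _ => (hA' w x).differentiableAt) (fun x _ => (hB' k w x).differentiableAt),
      neg_neg]
  have L : ∀ x, formInner (extDeriv a x) (b x) = ((i.factorial : ℂ))⁻¹ *
      ∑ k : Fin n, ∑ w : Fin i → Fin n, fderiv ℝ (A w) x (ek k) * B k w x := fun x => by
    rw [extDeriv, formInner_alternatize]
    simp only [(hA' _ x).fderiv]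
    rfl
  have R : ∀ x, formInner (a x) (codiff b x) = ((i.factorial : ℂ))⁻¹ *
      ∑ k : Fin n, ∑ w : Fin i → Fin n, -(A w x * fderiv ℝ (B k w) x (ek k)) := fun x => by
    rw [formInner, Finset.sum_comm]
    simp only [(hB' _ _ x).fderiv, Finset.sum_neg_distrib, ← Finset.mul_sum]
    congr 1
    rw [← Finset.sum_neg_distrib]
    refine Finset.sum_congr rfl fun w _ => ?_
    simp [hA, codiff, ContinuousAlternatingMap.apply]
  simp only [L, R, integral_const_mul]
  congr 1
  rw [integral_finsetSum _ fun k _ => integrable_finsetSum _ fun w _ => I1 k w,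
    integral_finsetSum _ fun k _ => integrable_finsetSum _ fun w _ => (N2 k w)]
  refine Finset.sum_congr rfl fun k _ => ?_
  rw [integral_finsetSum _ fun w _ => I1 k w, integral_finsetSum _ fun w _ => (N2 k w)]
  exact Finset.sum_congr rfl fun w _ => parts k w

end KnappStein

end

/-!
With `z = 2λ - n` the kernel is `Γ(z/2)⁻¹ |y| ^ (z - n) σ(ψ(y))`. Reflecting one argument after the
other, and using that a form vanishes on two proportional arguments, one finds
`|y|² σ(ψ(y)) = ∑ y_j y_k (δ_jk - 2 e_j ∧ ι_k)` (`sigma_psi_apply`). So everything reduces to the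
scalar distributions `Γ(z/2)⁻¹ |y| ^ (z - n - 2) y_j y_k`, which are paired with vector-valued
Schwartz functions.

A power of the norm is a Mellin transform of Gaussians `exp (-π t |y|²)`, and the Gaussians are
permuted by the Fourier transform, `t ↦ 1 / t`. This gives, in the strip `0 < Re z < n`, the Fourier
transform of these distributions (`normPowIntegral_mulCoord_fourier`):
`π ^ (n/2 - z) Γ((n - z)/2 + 1)⁻¹ (δ_jk / 2 |w| ^ (-z) - z / 2 |w| ^ (-z - 2) w_j w_k)`.
The pairing with the kernel converges and is holomorphic for `Re z > 0`, the one with its Fourier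
transform for `Re z < n`; glued along the strip they are an entire function of `z`, `rieszPairing`.
This is the analytic continuation of the convolution (`knappStein_eq_sum`). The value depends
smoothly on the base point: on one side it is the convolution of a locally integrable function with
a test function, on the other the Fourier transform of a rapidly decreasing function.

At `z = -2l` the Fourier side has a polynomial symbol, of which the inverse Fourier transform is
a combination of `Δˡ` and `∂_j ∂_k Δˡ⁻¹` (`rieszPairing_neg_even`). Summation against
`δ_jk - 2 e_j ∧ ι_k`, with `∑ e_j ∧ ι_j = i` and `d d* = -∑ (e_j ∧ ι_k) ∂_j ∂_k`, gives Branson's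
operator (`knappStein_half_sub`); for `l = 0` the result is a multiple of the identity.

If `n - 2λ` is not in `2ℕ`, then `Γ(λ - n/2)⁻¹ ≠ 0`. A differential operator is local, whereas for
`f` vanishing near `0` the value of the continued operator at `0` is the convergent integral of
`f (-y)` against the kernel at `y`. Were the operator differential, the kernel would
vanish away from the origin, but it is a nonzero multiple of the invertible map `σ(ψ(y))`
(`not_isDifferentialOperator_knappStein`).
-/

noncomputable section

namespace KnappStein

/-! ### Integrals against complex powers of the norm -/

section PowerIntegrals

variable {n : ℕ} {V : Type*} [NormedAddCommGroup V] [NormedSpace ℂ V]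

/-- The integral `∫ ‖y‖ ^ w • g y` of `g` against a complex power of the norm. -/
def normPowIntegral (w : ℂ) (g : E n → V) : V := ∫ y, ((‖y‖ : ℝ) : ℂ) ^ w • g y

theorem measurable_norm_cpow (w : ℂ) : Measurable fun y : E n => ((‖y‖ : ℝ) : ℂ) ^ w :=
  (Complex.measurable_ofReal.comp measurable_norm).pow_const w

theorem continuousAt_norm_cpow {y : E n} (hy : y ≠ 0) (w : ℂ) :
    ContinuousAt (fun y : E n => ((‖y‖ : ℝ) : ℂ) ^ w) y :=
  ContinuousAt.comp (g := fun r : ℂ => r ^ w) (f := fun y : E n => ((‖y‖ : ℝ) : ℂ))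
    (continuousAt_cpow_const (Complex.ofReal_mem_slitPlane.2 (norm_pos_iff.2 hy))) (by fun_prop)

theorem ae_ne_zero (hn : 1 ≤ n) : ∀ᵐ y : E n, y ≠ 0 := by
  have : Nonempty (Fin n) := ⟨⟨0, hn⟩⟩
  simp [ae_iff]

theorem norm_norm_cpow {y : E n} (hy : y ≠ 0) (w : ℂ) :
    ‖((‖y‖ : ℝ) : ℂ) ^ w‖ = ‖y‖ ^ w.re :=
  Complex.norm_cpow_eq_rpow_re_of_pos (norm_pos_iff.2 hy) w

/-- Away from the origin the Schwartz decay wins; near the origin the singularity is integrable. -/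
theorem integrable_norm_cpow_smul (hn : 1 ≤ n) {w : ℂ} {m : ℕ} (hw : -(n : ℝ) < w.re + m)
    (G : SchwartzMap (E n) V) {g : E n → V} (hgm : AEStronglyMeasurable g)
    (hg : ∀ y, ‖g y‖ ≤ ‖y‖ ^ m * ‖G y‖) :
    Integrable fun y => ((‖y‖ : ℝ) : ℂ) ^ w • g y := by
  have hmeas : AEStronglyMeasurable (fun y : E n => ((‖y‖ : ℝ) : ℂ) ^ w • g y) :=
    (measurable_norm_cpow w).aestronglyMeasurable.smul hgm
  obtain ⟨C, -, hC⟩ := G.decay 0 0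
  simp only [pow_zero, one_mul, norm_iteratedFDeriv_zero] at hC
  have key : ∀ y : E n, y ≠ 0 →
      ‖((‖y‖ : ℝ) : ℂ) ^ w • g y‖ ≤ ‖y‖ ^ (w.re + m) * ‖G y‖ := by
    intro y hy
    rw [norm_smul, norm_norm_cpow hy, Real.rpow_add (norm_pos_iff.2 hy), Real.rpow_natCast,
      mul_assoc]
    exact mul_le_mul_of_nonneg_left (hg y) (by positivity)
  rw [← integrableOn_univ, ← union_compl_self (Metric.ball (0 : E n) 1), integrableOn_union]
  constructor
  · refine integrableOn_ball_of_norm_le_rpow (C := C) (α := -(w.re + m)) (by simpa using hn)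
      (by simp only [finrank_euclideanSpace, Fintype.card_fin]; linarith) ?_ hmeas
    refine ae_restrict_of_ae ?_
    filter_upwards [ae_ne_zero hn] with y hy
    rw [neg_neg, mul_comm]
    exact (key y hy).trans (mul_le_mul_of_nonneg_left (hC y) (by positivity))
  · obtain ⟨N, hN⟩ := exists_nat_ge (w.re + m)
    refine Integrable.mono' (G.integrable_pow_mul volume N).integrableOn hmeas.restrict ?_
    refine (ae_restrict_iff' Metric.isOpen_ball.measurableSet.compl).2 (Filter.Eventually.of_forall
      fun y hy => ?_)
    have h1 : 1 ≤ ‖y‖ := by simpa using hy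
    refine (key y (norm_pos_iff.1 (by linarith))).trans ?_
    refine mul_le_mul_of_nonneg_right ?_ (norm_nonneg _)
    rw [← Real.rpow_natCast]
    exact Real.rpow_le_rpow_of_exponent_le h1 hN

/-- A logarithm is absorbed by a change of the exponent in both directions. This dominates the
derivative of `r ^ w` in `w`, uniformly for `w` near a given exponent. -/
theorem rpow_mul_abs_log_le {r a b ε : ℝ} (hr : 0 < r) (hε : 0 < ε) (hab : |b - a| ≤ ε) :
    r ^ b * |Real.log r| ≤ ε⁻¹ * (r ^ (a + 2 * ε) + r ^ (a - 2 * ε)) := by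
  obtain ⟨h1, h2⟩ := abs_le.1 hab
  rcases le_total 1 r with h | h
  · rw [abs_of_nonneg (Real.log_nonneg h)]
    have h3 : Real.log r ≤ r ^ ε / ε := Real.log_le_rpow_div hr.le hε
    calc r ^ b * Real.log r ≤ r ^ (a + ε) * (r ^ ε / ε) :=
          mul_le_mul (Real.rpow_le_rpow_of_exponent_le h (by linarith)) h3
            (Real.log_nonneg h) (by positivity)
      _ = ε⁻¹ * r ^ (a + 2 * ε) := by
          rw [show a + 2 * ε = (a + ε) + ε by ring, Real.rpow_add hr (a + ε)]; ring
      _ ≤ _ := by gcongr; linarith [Real.rpow_pos_of_pos hr (a - 2 * ε)]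
  · rw [abs_of_nonpos (Real.log_nonpos hr.le h), ← Real.log_inv]
    have h3 : Real.log r⁻¹ ≤ r⁻¹ ^ ε / ε := Real.log_le_rpow_div (by positivity) hε
    rw [Real.inv_rpow hr.le, ← Real.rpow_neg hr.le] at h3
    calc r ^ b * Real.log r⁻¹ ≤ r ^ (a - ε) * (r ^ (-ε) / ε) :=
          mul_le_mul (Real.rpow_le_rpow_of_exponent_ge hr h (by linarith)) h3
            (Real.log_nonneg ((one_le_inv₀ hr).2 h)) (by positivity)
      _ = ε⁻¹ * r ^ (a - 2 * ε) := by
          rw [show a - 2 * ε = (a - ε) + -ε by ring, Real.rpow_add hr (a - ε)]; ring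
      _ ≤ _ := by gcongr; linarith [Real.rpow_pos_of_pos hr (a + 2 * ε)]

theorem differentiableOn_normPowIntegral [CompleteSpace V] (hn : 1 ≤ n) {U : Set ℂ} (hU : IsOpen U)
    {g : E n → V} (hgm : AEStronglyMeasurable g)
    (hg : ∀ w ∈ U, Integrable fun y => ((‖y‖ : ℝ) : ℂ) ^ w • g y) :
    DifferentiableOn ℂ (fun w => normPowIntegral w g) U := by
  intro w₀ hw₀
  obtain ⟨δ, hδ, hball⟩ := Metric.isOpen_iff.1 hU w₀ hw₀
  set ε : ℝ := δ / 4 with hεdef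
  have hε : 0 < ε := by positivity
  have hmem : ∀ s : ℝ, |s| < δ → w₀ + s ∈ U := fun s hs => hball (by simpa using hs)
  have hmeas : ∀ w : ℂ, AEStronglyMeasurable (fun y : E n => ((‖y‖ : ℝ) : ℂ) ^ w • g y) :=
    fun w => (measurable_norm_cpow w).aestronglyMeasurable.smul hgm
  have hint : ∀ s : ℝ, |s| < δ → Integrable fun y : E n => ‖y‖ ^ (w₀.re + s) * ‖g y‖ := by
    intro s hs
    refine (hg _ (hmem s hs)).norm.congr ?_
    filter_upwards [ae_ne_zero hn] with y hy
    rw [norm_smul, norm_norm_cpow hy]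
    simp
  have h2 : |2 * ε| < δ := by rw [abs_of_pos (by positivity)]; linarith
  have hb : Integrable fun y : E n =>
      ε⁻¹ * (‖y‖ ^ (w₀.re + 2 * ε) * ‖g y‖ + ‖y‖ ^ (w₀.re + -(2 * ε)) * ‖g y‖) :=
    ((hint _ h2).add (hint _ (by rwa [abs_neg]))).const_mul _
  refine (hasDerivAt_integral_of_dominated_loc_of_deriv_le
    (F' := fun w y => (((‖y‖ : ℝ) : ℂ) ^ w * Complex.log (‖y‖ : ℝ)) • g y)
    (Metric.ball_mem_nhds w₀ hε) (Filter.Eventually.of_forall hmeas) (hg _ hw₀) ?_ ?_ hb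
    ?_).2.differentiableAt.differentiableWithinAt
  · exact (((measurable_norm_cpow w₀).mul (Complex.measurable_log.comp
      (Complex.measurable_ofReal.comp measurable_norm))).aestronglyMeasurable).smul hgm
  · filter_upwards [ae_ne_zero hn] with y hy w hw
    have hr : 0 < ‖y‖ := norm_pos_iff.2 hy
    rw [norm_smul, norm_mul, norm_norm_cpow hy, ← Complex.ofReal_log hr.le, Complex.norm_real,
      Real.norm_eq_abs, ← add_mul, ← mul_assoc]
    refine mul_le_mul_of_nonneg_right ?_ (norm_nonneg _)
    rw [← sub_eq_add_neg]
    refine rpow_mul_abs_log_le hr hε ?_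
    rw [← Complex.sub_re]
    exact (Complex.abs_re_le_norm _).trans (by simpa [dist_eq_norm] using (Metric.mem_ball.1 hw).le)
  · filter_upwards [ae_ne_zero hn] with y hy w hw
    have h0 : ((‖y‖ : ℝ) : ℂ) ≠ 0 := by simpa using hy
    have := ((hasDerivAt_id w).const_cpow (c := ((‖y‖ : ℝ) : ℂ)) (Or.inl h0)).smul_const (g y)
    simpa using this

/-- The product of `F` with the quadratic monomial `y_j y_k`. -/
def mulCoord (j k : Fin n) (F : E n → V) (y : E n) : V := ((y j * y k : ℝ) : ℂ) • F y

theorem norm_mulCoord_le (j k : Fin n) (F : E n → V) (y : E n) :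
    ‖mulCoord j k F y‖ ≤ ‖y‖ ^ 2 * ‖F y‖ := by
  rw [mulCoord, norm_smul, Complex.norm_real, norm_mul, sq]
  gcongr <;> exact PiLp.norm_apply_le y _

theorem continuous_mulCoord (j k : Fin n) {F : E n → V} (hF : Continuous F) :
    Continuous (mulCoord j k F) := by
  unfold mulCoord
  fun_prop

theorem integrable_cpow_mulCoord (hn : 1 ≤ n) {w : ℂ} (hw : -(n : ℝ) - 2 < w.re) (j k : Fin n)
    (F : SchwartzMap (E n) V) :
    Integrable fun y => ((‖y‖ : ℝ) : ℂ) ^ w • mulCoord j k F y :=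
  integrable_norm_cpow_smul hn (m := 2) (by push_cast; linarith) F
    (continuous_mulCoord j k F.continuous).aestronglyMeasurable (norm_mulCoord_le j k F)

theorem integrable_cpow_schwartz (hn : 1 ≤ n) {w : ℂ} (hw : -(n : ℝ) < w.re)
    (F : SchwartzMap (E n) V) :
    Integrable fun y => ((‖y‖ : ℝ) : ℂ) ^ w • F y :=
  integrable_norm_cpow_smul hn (m := 0) (by simpa using hw) F
    F.continuous.aestronglyMeasurable (by simp)

theorem isOpen_lt_re (a : ℝ) : IsOpen {w : ℂ | a < w.re} :=
  isOpen_lt continuous_const Complex.continuous_re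

theorem differentiableOn_normPowIntegral_mulCoord [CompleteSpace V] (hn : 1 ≤ n) (j k : Fin n)
    (F : SchwartzMap (E n) V) :
    DifferentiableOn ℂ (fun w => normPowIntegral w (mulCoord j k F))
      {w | -(n : ℝ) - 2 < w.re} :=
  differentiableOn_normPowIntegral hn (isOpen_lt_re _)
    (continuous_mulCoord j k F.continuous).aestronglyMeasurable
    fun _ hw => integrable_cpow_mulCoord hn hw j k F

theorem differentiableOn_normPowIntegral_schwartz [CompleteSpace V] (hn : 1 ≤ n)
    (F : SchwartzMap (E n) V) :
    DifferentiableOn ℂ (fun w => normPowIntegral w F) {w | -(n : ℝ) < w.re} :=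
  differentiableOn_normPowIntegral hn (isOpen_lt_re _) F.continuous.aestronglyMeasurable
    fun _ hw => integrable_cpow_schwartz hn hw F

end PowerIntegrals

/-! ### Powers of the norm as superpositions of Gaussians -/

section GaussianMellin

variable {n : ℕ} {V : Type*} [NormedAddCommGroup V] [NormedSpace ℂ V]

/-- The integral of `h` against the Gaussian `exp (-π t ‖y‖²)`. -/
def gaussianIntegral (h : E n → V) (t : ℝ) : V :=
  ∫ y, Complex.exp (-(Real.pi * t) * (‖y‖ : ℂ) ^ 2) • h y

theorem one_div_pi_mul_sq_cpow {r : ℝ} (hr : 0 < r) (b : ℂ) :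
    (1 / ((Real.pi * r ^ 2 : ℝ) : ℂ)) ^ b = (Real.pi : ℂ) ^ (-b) * (r : ℂ) ^ (-2 * b) := by
  have hp := Real.pi_pos
  have hr0 : (r : ℂ) ≠ 0 := by exact_mod_cast hr.ne'
  have harg : (((Real.pi * r ^ 2 : ℝ) : ℂ)).arg ≠ Real.pi := by
    rw [Complex.arg_ofReal_of_nonneg (by positivity)]; exact hp.ne
  rw [one_div, Complex.inv_cpow _ _ harg, ← Complex.cpow_neg, Complex.ofReal_mul,
    Complex.mul_cpow_ofReal_nonneg hp.le (by positivity), sq, Complex.ofReal_mul,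
    Complex.mul_cpow_ofReal_nonneg hr.le hr.le, ← Complex.cpow_add _ _ hr0]
  ring_nf

theorem norm_gaussian (y : E n) (t : ℝ) :
    ‖Complex.exp (-(Real.pi * t) * (‖y‖ : ℂ) ^ 2)‖ = Real.exp (-(Real.pi * ‖y‖ ^ 2) * t) := by
  rw [Complex.norm_exp]
  congr 1
  have : (-(Real.pi * t) * (‖y‖ : ℂ) ^ 2) = ((-(Real.pi * ‖y‖ ^ 2) * t : ℝ) : ℂ) := by
    push_cast; ring
  rw [this, Complex.ofReal_re]

theorem integrable_prod_gaussian (hn : 1 ≤ n) {b : ℂ} (hb : 0 < b.re) {h : E n → V}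
    (hm : AEStronglyMeasurable h)
    (hh : Integrable fun y => ((‖y‖ : ℝ) : ℂ) ^ (-2 * b) • h y) :
    Integrable (fun p : ℝ × E n => ((p.1 : ℂ) ^ (b - 1) *
      Complex.exp (-(Real.pi * p.1) * (‖p.2‖ : ℂ) ^ 2)) • h p.2)
      ((volume.restrict (Ioi (0 : ℝ))).prod volume) := by
  have hmeas : AEStronglyMeasurable (fun p : ℝ × E n => ((p.1 : ℂ) ^ (b - 1) *
      Complex.exp (-(Real.pi * p.1) * (‖p.2‖ : ℂ) ^ 2)) • h p.2)
      ((volume.restrict (Ioi (0 : ℝ))).prod volume) := by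
    refine AEStronglyMeasurable.smul (Measurable.aestronglyMeasurable ?_) hm.comp_snd
    refine Measurable.mul ?_ ?_
    · exact (Complex.measurable_ofReal.comp measurable_fst).pow_const _
    · fun_prop
  have hnorm : ∀ y : E n, ∀ t ∈ Ioi (0 : ℝ), ‖((t : ℂ) ^ (b - 1) *
      Complex.exp (-(Real.pi * t) * (‖y‖ : ℂ) ^ 2)) • h y‖ =
      t ^ (b.re - 1) * Real.exp (-(Real.pi * ‖y‖ ^ 2) * t) * ‖h y‖ := by
    intro y t ht
    rw [norm_smul, norm_mul, norm_gaussian, Complex.norm_cpow_eq_rpow_re_of_pos ht]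
    simp
  rw [integrable_prod_iff' hmeas]
  constructor
  · filter_upwards [ae_ne_zero hn] with y hy
    have hr : 0 < Real.pi * ‖y‖ ^ 2 := by have := norm_pos_iff.2 hy; positivity
    have h1 : AEStronglyMeasurable (fun t : ℝ => ((t : ℂ) ^ (b - 1) *
      Complex.exp (-(Real.pi * t) * (‖y‖ : ℂ) ^ 2)) • h y) (volume.restrict (Ioi 0)) := by
      refine AEStronglyMeasurable.smul (Measurable.aestronglyMeasurable ?_)
        aestronglyMeasurable_const
      exact (Complex.measurable_ofReal.pow_const _).mul (by fun_prop)
    refine Integrable.mono' (((integrableOn_rpow_mul_exp_neg_mul_rpow (s := b.re - 1) (p := 1)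
      (by linarith) one_pos hr).mul_const ‖h y‖)) h1 ?_
    refine (ae_restrict_iff' measurableSet_Ioi).2 (Filter.Eventually.of_forall fun t ht => ?_)
    rw [hnorm y t ht, Real.rpow_one]
  · refine (hh.norm.const_mul (Real.pi ^ (-b.re) * Real.Gamma b.re)).congr ?_
    filter_upwards [ae_ne_zero hn] with y hy
    have hy' := norm_pos_iff.2 hy
    have hr : 0 < Real.pi * ‖y‖ ^ 2 := by positivity
    rw [setIntegral_congr_fun measurableSet_Ioi (hnorm y), integral_mul_const]
    simp only [neg_mul]
    rw [Real.integral_rpow_mul_exp_neg_mul_Ioi hb hr, norm_smul, norm_norm_cpow hy]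
    have h1 : (1 / (Real.pi * ‖y‖ ^ 2)) ^ b.re = Real.pi ^ (-b.re) * ‖y‖ ^ (-2 * b).re := by
      rw [one_div, Real.inv_rpow hr.le, ← Real.rpow_neg hr.le,
        Real.mul_rpow Real.pi_pos.le (by positivity), ← Real.rpow_natCast, ← Real.rpow_mul hy'.le]
      congr 2
      simp
    rw [h1, neg_mul]
    ring

theorem integrableOn_cpow_smul_gaussianIntegral (hn : 1 ≤ n) {b : ℂ} (hb : 0 < b.re)
    {h : E n → V} (hm : AEStronglyMeasurable h)
    (hh : Integrable fun y => ((‖y‖ : ℝ) : ℂ) ^ (-2 * b) • h y) :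
    IntegrableOn (fun t : ℝ => (t : ℂ) ^ (b - 1) • gaussianIntegral h t) (Ioi 0) := by
  refine (integrable_prod_gaussian hn hb hm hh).integral_prod_left.congr
    (Filter.Eventually.of_forall fun t => ?_)
  simp only [gaussianIntegral, mul_smul]
  rw [integral_smul]

/-- A power of the norm is the Mellin transform in `t` of the Gaussians `exp (-π t ‖y‖²)`. -/
theorem setIntegral_cpow_smul_gaussianIntegral [CompleteSpace V] (hn : 1 ≤ n) {b : ℂ}
    (hb : 0 < b.re) {h : E n → V} (hm : AEStronglyMeasurable h)
    (hh : Integrable fun y => ((‖y‖ : ℝ) : ℂ) ^ (-2 * b) • h y) :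
    ∫ t in Ioi (0 : ℝ), (t : ℂ) ^ (b - 1) • gaussianIntegral h t =
      ((Real.pi : ℂ) ^ (-b) * Complex.Gamma b) • normPowIntegral (-2 * b) h := by
  simp only [gaussianIntegral, ← integral_smul, smul_smul]
  rw [integral_integral_swap (integrable_prod_gaussian hn hb hm hh), normPowIntegral,
    ← integral_smul]
  refine integral_congr_ae ?_
  filter_upwards [ae_ne_zero hn] with y hy
  have hy' := norm_pos_iff.2 hy
  have hr : 0 < Real.pi * ‖y‖ ^ 2 := by positivity
  rw [integral_smul_const, smul_smul]
  congr 1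
  have h1 := Complex.integral_cpow_mul_exp_neg_mul_Ioi hb hr
  rw [one_div_pi_mul_sq_cpow hy'] at h1
  rw [mul_right_comm, ← h1]
  refine setIntegral_congr_fun measurableSet_Ioi fun t _ => ?_
  congr 2
  push_cast
  ring

/-- The change of variables `t ↦ 1 / t`. -/
theorem setIntegral_cpow_smul_comp_inv (b : ℂ) (φ : ℝ → V) :
    ∫ t in Ioi (0 : ℝ), (t : ℂ) ^ (-b - 1) • φ t⁻¹ =
      ∫ t in Ioi (0 : ℝ), (t : ℂ) ^ (b - 1) • φ t := by
  rw [← integral_comp_rpow_Ioi (fun t : ℝ => (t : ℂ) ^ (b - 1) • φ t) (p := -1) (by norm_num)]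
  refine setIntegral_congr_fun measurableSet_Ioi fun t ht => ?_
  have ht0 : (t : ℂ) ≠ 0 := by exact_mod_cast (ne_of_gt ht)
  have harg : (t : ℂ).arg ≠ Real.pi := by
    rw [Complex.arg_ofReal_of_nonneg (le_of_lt ht)]; exact Real.pi_pos.ne
  simp only [Real.rpow_neg_one, abs_neg, abs_one, one_mul, Complex.ofReal_inv]
  rw [Complex.inv_cpow _ _ harg, ← Complex.cpow_neg, ← Complex.coe_smul, smul_smul,
    Complex.ofReal_cpow (le_of_lt ht), ← Complex.cpow_add _ _ ht0]
  congr 2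
  push_cast
  ring

theorem integrableOn_cpow_smul_comp_inv {b : ℂ} {φ : ℝ → V}
    (h : IntegrableOn (fun t : ℝ => (t : ℂ) ^ (b - 1) • φ t) (Ioi 0)) :
    IntegrableOn (fun t : ℝ => (t : ℂ) ^ (-b - 1) • φ t⁻¹) (Ioi 0) := by
  rw [← integrableOn_Ioi_comp_rpow_iff _ (p := -1) (by norm_num)] at h
  refine h.congr_fun (fun t ht => ?_) measurableSet_Ioi
  have ht0 : (t : ℂ) ≠ 0 := by exact_mod_cast (ne_of_gt ht)
  have harg : (t : ℂ).arg ≠ Real.pi := by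
    rw [Complex.arg_ofReal_of_nonneg (le_of_lt ht)]; exact Real.pi_pos.ne
  simp only [Real.rpow_neg_one, abs_neg, abs_one, one_mul, Complex.ofReal_inv]
  rw [Complex.inv_cpow _ _ harg, ← Complex.cpow_neg, ← Complex.coe_smul, smul_smul,
    Complex.ofReal_cpow (le_of_lt ht), ← Complex.cpow_add _ _ ht0]
  congr 2
  push_cast
  ring

end GaussianMellin

/-! ### The Fourier transform of `y_j y_k |y| ^ (z - n - 2)` -/

section GaussianParseval

open scoped FourierTransform LineDeriv

variable {n : ℕ} {V : Type*} [NormedAddCommGroup V] [NormedSpace ℂ V]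

theorem integrable_smul_schwartz {u : E n → ℂ} (hu : Continuous u) {m : ℕ}
    (hb : ∀ y, ‖u y‖ ≤ ‖y‖ ^ m) (G : SchwartzMap (E n) V) : Integrable fun y => u y • G y := by
  refine Integrable.mono' (G.integrable_pow_mul volume m)
    (hu.smul G.continuous).aestronglyMeasurable (Filter.Eventually.of_forall fun y => ?_)
  rw [norm_smul]
  gcongr
  exact hb y

theorem norm_gaussian_le_one (y : E n) {t : ℝ} (ht : 0 < t) :
    ‖Complex.exp (-(Real.pi * t) * (‖y‖ : ℂ) ^ 2)‖ ≤ 1 := by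
  rw [norm_gaussian, Real.exp_le_one_iff]
  have := Real.pi_pos
  nlinarith [sq_nonneg ‖y‖, mul_nonneg (mul_nonneg this.le (sq_nonneg ‖y‖)) ht.le]

theorem hasFDerivAt_gaussian (t : ℝ) (y : E n) :
    HasFDerivAt (fun y : E n => Complex.exp (-(Real.pi * t) * (‖y‖ : ℂ) ^ 2))
      ((-(2 * Real.pi * t) * Complex.exp (-(Real.pi * t) * (‖y‖ : ℂ) ^ 2)) •
        (Complex.ofRealCLM.comp (innerSL ℝ y))) y := by
  have h1 : HasFDerivAt (fun y : E n => ‖y‖ ^ 2) (2 • innerSL ℝ y) y :=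
    (hasStrictFDerivAt_norm_sq y).hasFDerivAt
  have h2 := ((Complex.ofRealCLM.hasFDerivAt.comp y h1).const_mul (-(Real.pi * t : ℂ))).cexp
  have h3 : (fun y : E n => Complex.exp (-(Real.pi * t) * (‖y‖ : ℂ) ^ 2)) =
      fun y => Complex.exp
        (-(Real.pi * t : ℂ) * (Complex.ofRealCLM ∘ fun y : E n => ‖y‖ ^ 2) y) := by
    ext y; simp
  rw [h3]
  refine h2.congr_fderiv ?_
  ext v
  simp
  ring

theorem inner_ek (y : E n) (k : Fin n) : ⟪y, ek k⟫ = y k := by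
  simp [ek, EuclideanSpace.inner_single_right]

theorem integrable_gaussian_smul {t : ℝ} (ht : 0 < t) (G : SchwartzMap (E n) V) :
    Integrable fun y => Complex.exp (-(Real.pi * t) * (‖y‖ : ℂ) ^ 2) • G y :=
  integrable_smul_schwartz (m := 0) (by fun_prop)
    (fun y => by simpa using norm_gaussian_le_one y ht) G

theorem integrable_coord_gaussian_smul {t : ℝ} (ht : 0 < t) (k : Fin n) (G : SchwartzMap (E n) V) :
    Integrable fun y => ((y k : ℂ) * Complex.exp (-(Real.pi * t) * (‖y‖ : ℂ) ^ 2)) • G y := by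
  refine integrable_smul_schwartz (m := 1) (by fun_prop) (fun y => ?_) G
  rw [norm_mul, pow_one, Complex.norm_real]
  exact (mul_le_mul (PiLp.norm_apply_le y k) (norm_gaussian_le_one y ht)
    (norm_nonneg _) (norm_nonneg _)).trans_eq (mul_one _)

theorem integrable_gaussian_mulCoord {t : ℝ} (ht : 0 < t) (j k : Fin n)
    (G : SchwartzMap (E n) V) :
    Integrable fun y => Complex.exp (-(Real.pi * t) * (‖y‖ : ℂ) ^ 2) • mulCoord j k G y := by
  simp only [mulCoord, smul_smul]
  refine integrable_smul_schwartz (m := 2) (by fun_prop) (fun y => ?_) G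
  rw [norm_mul, mul_comm, Complex.norm_real, norm_mul, pow_two ‖y‖]
  exact (mul_le_mul (mul_le_mul (PiLp.norm_apply_le y j) (PiLp.norm_apply_le y k)
    (norm_nonneg _) (norm_nonneg _)) (norm_gaussian_le_one y ht) (norm_nonneg _)
    (by positivity)).trans_eq (mul_one _)

/-- Integration by parts against `exp (-π t ‖y‖²)`. -/
theorem integral_gaussian_lineDeriv [CompleteSpace V] {t : ℝ} (ht : 0 < t) (k : Fin n)
    (G : SchwartzMap (E n) V) :
    ∫ y, Complex.exp (-(Real.pi * t) * (‖y‖ : ℂ) ^ 2) • (∂_{(ek k : E n)} G) y =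
      (2 * Real.pi * t : ℂ) •
        ∫ y, ((y k : ℂ) * Complex.exp (-(Real.pi * t) * (‖y‖ : ℂ) ^ 2)) • G y := by
  have hd : ∀ y : E n,
      fderiv ℝ (fun y : E n => Complex.exp (-(Real.pi * t) * (‖y‖ : ℂ) ^ 2)) y (ek k) =
        -(2 * Real.pi * t : ℂ) * ((y k : ℂ) * Complex.exp (-(Real.pi * t) * (‖y‖ : ℂ) ^ 2)) := by
    intro y
    rw [(hasFDerivAt_gaussian t y).fderiv]
    simp [inner_ek]
    ring
  have := integral_smul_fderiv_eq_neg_fderiv_smul_of_integrable (μ := volume) (𝕜 := ℂ)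
    (f := fun y : E n => Complex.exp (-(Real.pi * t) * (‖y‖ : ℂ) ^ 2)) (g := G) (v := ek k)
    (by
      simp only [hd, mul_smul (-(2 * Real.pi * t : ℂ))]
      exact (integrable_coord_gaussian_smul ht k G).smul (-(2 * Real.pi * t : ℂ)))
    (integrable_gaussian_smul ht (∂_{(ek k : E n)} G)) (integrable_gaussian_smul ht G)
    (fun y _ => (hasFDerivAt_gaussian t y).differentiableAt)
    (fun y _ => G.differentiableAt)
  simp only [hd, mul_smul (-(2 * Real.pi * t : ℂ))] at this
  rw [integral_smul, neg_smul, neg_neg] at this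
  exact this

theorem integral_coord_gaussian_lineDeriv [CompleteSpace V] {t : ℝ} (ht : 0 < t) (j k : Fin n)
    (G : SchwartzMap (E n) V) :
    ∫ y, ((y k : ℂ) * Complex.exp (-(Real.pi * t) * (‖y‖ : ℂ) ^ 2)) • (∂_{(ek j : E n)} G) y =
      (2 * Real.pi * t : ℂ) • gaussianIntegral (mulCoord j k G) t -
        (if j = k then (1 : ℂ) else 0) • gaussianIntegral G t := by
  have hd0 : ∀ y : E n, HasFDerivAt
      (fun y : E n => (y k : ℂ) * Complex.exp (-(Real.pi * t) * (‖y‖ : ℂ) ^ 2)) _ y := fun y =>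
    (Complex.ofRealCLM.hasFDerivAt.comp y
      (EuclideanSpace.proj (𝕜 := ℝ) k : E n →L[ℝ] ℝ).hasFDerivAt).mul (hasFDerivAt_gaussian t y)
  have hd : ∀ y : E n, fderiv ℝ
      (fun y : E n => (y k : ℂ) * Complex.exp (-(Real.pi * t) * (‖y‖ : ℂ) ^ 2)) y (ek j)
      = (if j = k then (1 : ℂ) else 0) * Complex.exp (-(Real.pi * t) * (‖y‖ : ℂ) ^ 2) -
        (2 * Real.pi * t : ℂ) *
          (Complex.exp (-(Real.pi * t) * (‖y‖ : ℂ) ^ 2) * ((y j * y k : ℝ) : ℂ)) := by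
    intro y
    rw [(hd0 y).fderiv]
    by_cases h : j = k
    · subst h
      simp [inner_ek]
      ring
    · simp [h, Ne.symm h, inner_ek]
      ring
  have hI1 : Integrable fun y : E n => (if j = k then (1 : ℂ) else 0) •
      (Complex.exp (-(Real.pi * t) * (‖y‖ : ℂ) ^ 2) • G y) :=
    (integrable_gaussian_smul ht G).smul (if j = k then (1 : ℂ) else 0)
  have hI2 : Integrable fun y : E n => (2 * Real.pi * t : ℂ) •
      (Complex.exp (-(Real.pi * t) * (‖y‖ : ℂ) ^ 2) • mulCoord j k G y) :=
    (integrable_gaussian_mulCoord ht j k G).smul (2 * Real.pi * t : ℂ)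
  have hd' : ∀ y : E n, fderiv ℝ
      (fun y : E n => (y k : ℂ) * Complex.exp (-(Real.pi * t) * (‖y‖ : ℂ) ^ 2)) y (ek j) • G y =
      (if j = k then (1 : ℂ) else 0) • (Complex.exp (-(Real.pi * t) * (‖y‖ : ℂ) ^ 2) • G y) -
      (2 * Real.pi * t : ℂ) •
        (Complex.exp (-(Real.pi * t) * (‖y‖ : ℂ) ^ 2) • mulCoord j k G y) := by
    intro y
    rw [hd, sub_smul, mul_smul, mul_smul (2 * Real.pi * t : ℂ), mul_smul (Complex.exp _), mulCoord]
  have := integral_smul_fderiv_eq_neg_fderiv_smul_of_integrable (μ := volume) (𝕜 := ℂ)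
    (f := fun y : E n => (y k : ℂ) * Complex.exp (-(Real.pi * t) * (‖y‖ : ℂ) ^ 2)) (g := G)
    (v := ek j)
    (by simp only [hd']; exact hI1.sub hI2)
    (integrable_coord_gaussian_smul ht k (∂_{(ek j : E n)} G))
    (integrable_coord_gaussian_smul ht k G)
    (fun y _ => (hd0 y).differentiableAt)
    (fun y _ => G.differentiableAt)
  refine this.trans ?_
  simp only [hd']
  rw [integral_sub hI1 hI2, integral_smul, integral_smul, neg_sub]
  rfl

theorem fourier_gaussian {t : ℝ} (ht : 0 < t) (w : E n) :
    𝓕 (fun y : E n => Complex.exp (-(Real.pi * t) * (‖y‖ : ℂ) ^ 2)) w =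
      (t : ℂ) ^ (-(n : ℂ) / 2) * Complex.exp (-(Real.pi * t⁻¹) * (‖w‖ : ℂ) ^ 2) := by
  have hpt : 0 < ((Real.pi * t : ℂ)).re := by
    rw [← Complex.ofReal_mul, Complex.ofReal_re]; exact mul_pos Real.pi_pos ht
  have hp : (Real.pi : ℂ) ≠ 0 := by exact_mod_cast Real.pi_ne_zero
  have ht0 : (t : ℂ) ≠ 0 := by exact_mod_cast ht.ne'
  have harg : (t : ℂ).arg ≠ Real.pi := by
    rw [Complex.arg_ofReal_of_nonneg ht.le]; exact Real.pi_pos.ne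
  rw [fourier_gaussian_innerProductSpace hpt, finrank_euclideanSpace, Fintype.card_fin]
  congr 1
  · rw [div_mul_cancel_left₀ hp, Complex.inv_cpow _ _ harg, ← Complex.cpow_neg, neg_div]
  · congr 1
    push_cast
    field_simp

theorem fourier_lineDeriv_ek_apply (H : SchwartzMap (E n) V) (j : Fin n) (y : E n) :
    (𝓕 (∂_{(ek j : E n)} H) : SchwartzMap (E n) V) y =
      (2 * Real.pi * Complex.I * y j) • (𝓕 H : SchwartzMap (E n) V) y := by
  have hg : (fun x : E n => inner ℝ x (ek j)).HasTemperateGrowth := by fun_prop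
  rw [SchwartzMap.fourier_lineDerivOp_eq, smul_apply,
    SchwartzMap.smulLeftCLM_apply_apply hg, inner_ek]
  simp only [mul_smul, Complex.coe_smul]

/-- The Fourier transform of `y_j y_k exp (-π t ‖y‖²)`, tested against a Schwartz function. -/
theorem gaussianIntegral_mulCoord_fourier [CompleteSpace V] {t : ℝ} (ht : 0 < t) (j k : Fin n)
    (H : SchwartzMap (E n) V) :
    gaussianIntegral (mulCoord j k (𝓕 H : SchwartzMap (E n) V)) t = (t : ℂ) ^ (-(n : ℂ) / 2) •
      (((if j = k then (1 : ℂ) else 0) / (2 * Real.pi * t)) • gaussianIntegral H t⁻¹ -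
        ((t : ℂ) ^ 2)⁻¹ • gaussianIntegral (mulCoord j k H) t⁻¹) := by
  have hp : (Real.pi : ℂ) ≠ 0 := by exact_mod_cast Real.pi_ne_zero
  have ht0 : (t : ℂ) ≠ 0 := by exact_mod_cast ht.ne'
  have ht' : 0 < t⁻¹ := inv_pos.2 ht
  -- multiplication by `y_j y_k` is a second derivative on the Fourier side
  have h1 : ∀ y : E n, mulCoord j k (𝓕 H : SchwartzMap (E n) V) y =
      (-(4 * (Real.pi : ℂ) ^ 2)⁻¹) •
        (𝓕 (∂_{(ek k : E n)} (∂_{(ek j : E n)} H)) : SchwartzMap (E n) V) y := by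
    intro y
    rw [fourier_lineDeriv_ek_apply, fourier_lineDeriv_ek_apply, mulCoord, smul_smul, smul_smul]
    congr 1
    push_cast
    field_simp
    linear_combination (4 * y j * y k : ℂ) * Complex.I_sq
  have hJ : Integrable (fun y : E n => Complex.exp (-(Real.pi * t) * (‖y‖ : ℂ) ^ 2)) := by
    have hpt : 0 < ((Real.pi * t : ℂ)).re := by
      rw [← Complex.ofReal_mul, Complex.ofReal_re]; exact mul_pos Real.pi_pos ht
    simpa using GaussianFourier.integrable_cexp_neg_mul_sq_norm_add (V := E n) hpt 0 0
  -- Parseval's formula against the Gaussian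
  have h2 : ∀ G : SchwartzMap (E n) V,
      gaussianIntegral (𝓕 G : SchwartzMap (E n) V) t =
        (t : ℂ) ^ (-(n : ℂ) / 2) • gaussianIntegral G t⁻¹ := by
    intro G
    have h3 := VectorFourier.integral_fourierIntegral_smul_eq_flip (L := innerₗ (E n))
      Real.continuous_fourierChar continuous_inner hJ (G.integrable (μ := volume))
    have h4 : ∫ w, 𝓕 (fun y : E n => Complex.exp (-(Real.pi * t) * (‖y‖ : ℂ) ^ 2)) w • G w =
      ∫ y, Complex.exp (-(Real.pi * t) * (‖y‖ : ℂ) ^ 2) • (𝓕 G : SchwartzMap (E n) V) y := by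
      simpa using! h3
    rw [gaussianIntegral, ← h4, gaussianIntegral, ← integral_smul]
    simp only [fourier_gaussian ht, mul_smul]
  have h5 : gaussianIntegral (mulCoord j k (𝓕 H : SchwartzMap (E n) V)) t =
      (-(4 * (Real.pi : ℂ) ^ 2)⁻¹) • gaussianIntegral
        (𝓕 (∂_{(ek k : E n)} (∂_{(ek j : E n)} H)) : SchwartzMap (E n) V) t := by
    simp only [gaussianIntegral]
    rw [← integral_smul]
    refine integral_congr_ae (Filter.Eventually.of_forall fun y => ?_)
    simp only [h1]
    rw [smul_comm]
  rw [h5, h2, gaussianIntegral, integral_gaussian_lineDeriv ht',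
    integral_coord_gaussian_lineDeriv ht', smul_comm]
  congr 1
  simp only [smul_sub, smul_smul]
  push_cast
  rw [show (-(4 * (Real.pi : ℂ) ^ 2)⁻¹ * (2 * Real.pi * (t : ℂ)⁻¹ * (2 * Real.pi * (t : ℂ)⁻¹))) =
      -((t : ℂ) ^ 2)⁻¹ by field_simp; ring,
    show (-(4 * (Real.pi : ℂ) ^ 2)⁻¹ * (2 * Real.pi * (t : ℂ)⁻¹ * if j = k then 1 else 0)) =
      -((if j = k then 1 else 0) / (2 * Real.pi * t)) by field_simp; ring]
  simp only [neg_smul]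
  abel

/-- The scalar factor `π ^ (n/2 - z) Γ((n - z)/2 + 1)⁻¹` in the Fourier transform of
`Γ(z/2)⁻¹ |y| ^ (z - n - 2) y_j y_k`. -/
def symbolFactor (n : ℕ) (z : ℂ) : ℂ :=
  (Real.pi : ℂ) ^ ((n : ℂ) / 2 - z) * (Complex.Gamma (((n : ℂ) - z) / 2 + 1))⁻¹

/-- The Fourier transform of the kernel `Γ(z/2)⁻¹ |y|^{z-n-2} y_j y_k` in the strip
`0 < Re z < n`, tested against a Schwartz function. -/
theorem normPowIntegral_mulCoord_fourier [CompleteSpace V] (hn : 1 ≤ n) {z : ℂ} (hz0 : 0 < z.re)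
    (hzn : z.re < n) (j k : Fin n) (H : SchwartzMap (E n) V) :
    (Complex.Gamma (z / 2))⁻¹ •
        normPowIntegral (z - n - 2) (mulCoord j k (𝓕 H : SchwartzMap (E n) V)) =
      symbolFactor n z • (((if j = k then (1 : ℂ) else 0) / 2) • normPowIntegral (-z) H -
        (z / 2) • normPowIntegral (-z - 2) (mulCoord j k H)) := by
  have hp : (Real.pi : ℂ) ≠ 0 := by exact_mod_cast Real.pi_ne_zero
  set a : ℂ := ((n : ℂ) - z) / 2 + 1 with ha
  have ha2 : -2 * a = z - n - 2 := by rw [ha]; ring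
  have hb2 : -2 * (z / 2) = -z := by ring
  have hc2 : -2 * (z / 2 + 1) = -z - 2 := by ring
  have hre2 : (z / 2).re = z.re / 2 := by
    rw [show (2 : ℂ) = ((2 : ℝ) : ℂ) by norm_num, Complex.div_ofReal_re]
  have hare : 0 < a.re := by
    have : (((n : ℂ) - z) / 2).re = (n - z.re) / 2 := by
      rw [show (2 : ℂ) = ((2 : ℝ) : ℂ) by norm_num, Complex.div_ofReal_re]; simp
    rw [ha, Complex.add_re, this, Complex.one_re]; linarith
  have hbre : 0 < (z / 2).re := by rw [hre2]; linarith
  have hcre : 0 < (z / 2 + 1).re := by rw [Complex.add_re, hre2, Complex.one_re]; linarith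
  have hGz : Complex.Gamma (z / 2) ≠ 0 := Complex.Gamma_ne_zero_of_re_pos hbre
  have hGa : Complex.Gamma a ≠ 0 := Complex.Gamma_ne_zero_of_re_pos hare
  have hz2 : z / 2 ≠ 0 := fun h => by rw [h] at hbre; simp at hbre
  have hmF := (continuous_mulCoord j k (𝓕 H : SchwartzMap (E n) V).continuous).aestronglyMeasurable
    (μ := volume)
  have hmH := (continuous_mulCoord j k H.continuous).aestronglyMeasurable (μ := volume)
  have hIF : Integrable fun y => ((‖y‖ : ℝ) : ℂ) ^ (-2 * a) •
      mulCoord j k (𝓕 H : SchwartzMap (E n) V) y :=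
    integrable_cpow_mulCoord hn (by rw [ha2]; simp; linarith) j k _
  have hIH : Integrable fun y => ((‖y‖ : ℝ) : ℂ) ^ (-2 * (z / 2)) • H y :=
    integrable_cpow_schwartz hn (by rw [hb2]; simp; linarith) H
  have hIM : Integrable fun y => ((‖y‖ : ℝ) : ℂ) ^ (-2 * (z / 2 + 1)) • mulCoord j k H y :=
    integrable_cpow_mulCoord hn (by rw [hc2]; simp; linarith) j k H
  -- the Mellin representations with exponents `a`, `z / 2` and `z / 2 + 1`; the change
  -- of variables `t ↦ 1 / t` in the last two brings all three integrals to the same variable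
  have h1 := setIntegral_cpow_smul_gaussianIntegral hn hare hmF hIF
  have h2 := setIntegral_cpow_smul_gaussianIntegral hn hbre H.continuous.aestronglyMeasurable hIH
  have h3 := setIntegral_cpow_smul_gaussianIntegral hn hcre hmH hIM
  have i2 := integrableOn_cpow_smul_comp_inv
    (integrableOn_cpow_smul_gaussianIntegral hn hbre H.continuous.aestronglyMeasurable hIH)
  have i3 := integrableOn_cpow_smul_comp_inv
    (integrableOn_cpow_smul_gaussianIntegral hn hcre hmH hIM)
  rw [← setIntegral_cpow_smul_comp_inv] at h2 h3
  have h4 : ∫ t in Ioi (0 : ℝ), (t : ℂ) ^ (a - 1) •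
      gaussianIntegral (mulCoord j k (𝓕 H : SchwartzMap (E n) V)) t =
      ∫ t in Ioi (0 : ℝ), (((if j = k then (1 : ℂ) else 0) / (2 * Real.pi)) •
        ((t : ℂ) ^ (-(z / 2) - 1) • gaussianIntegral H t⁻¹) -
        (t : ℂ) ^ (-(z / 2 + 1) - 1) • gaussianIntegral (mulCoord j k H) t⁻¹) := by
    refine setIntegral_congr_fun measurableSet_Ioi fun t ht => ?_
    have ht0 : (t : ℂ) ≠ 0 := by exact_mod_cast (ne_of_gt ht)
    have e0 : (t : ℂ) ^ (a - 1) * (t : ℂ) ^ (-(n : ℂ) / 2) = (t : ℂ) ^ (-(z / 2)) := by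
      rw [← Complex.cpow_add _ _ ht0]; congr 1; rw [ha]; ring
    have e1 : (t : ℂ) ^ (-(z / 2) - 1) = (t : ℂ) ^ (-(z / 2)) / t := by
      rw [Complex.cpow_sub _ _ ht0, Complex.cpow_one]
    have e2 : (t : ℂ) ^ (-(z / 2 + 1) - 1) = (t : ℂ) ^ (-(z / 2)) / t ^ 2 := by
      rw [show -(z / 2 + 1) - 1 = -(z / 2) - (2 : ℕ) by push_cast; ring, Complex.cpow_sub _ _ ht0,
        Complex.cpow_natCast]
    rw [gaussianIntegral_mulCoord_fourier ht, smul_smul, e0, e1, e2, smul_sub, smul_smul, smul_smul,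
      smul_smul]
    congr 2
    · field_simp
  have i2' : IntegrableOn (fun t : ℝ => ((if j = k then (1 : ℂ) else 0) / (2 * Real.pi)) •
      ((t : ℂ) ^ (-(z / 2) - 1) • gaussianIntegral H t⁻¹)) (Ioi 0) :=
    i2.smul ((if j = k then (1 : ℂ) else 0) / (2 * Real.pi))
  rw [h4, integral_sub i2' i3, integral_smul, h2, h3, ha2, hb2, hc2] at h1
  have h5 : normPowIntegral (z - n - 2) (mulCoord j k (𝓕 H : SchwartzMap (E n) V)) =
      ((Real.pi : ℂ) ^ a * (Complex.Gamma a)⁻¹) • (((Real.pi : ℂ) ^ (-a) * Complex.Gamma a) •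
        normPowIntegral (z - n - 2) (mulCoord j k (𝓕 H : SchwartzMap (E n) V))) := by
    rw [smul_smul, Complex.cpow_neg]
    have : (Real.pi : ℂ) ^ a ≠ 0 := by simp [Complex.cpow_eq_zero_iff, hp]
    rw [show (Real.pi : ℂ) ^ a * (Complex.Gamma a)⁻¹ * (((Real.pi : ℂ) ^ a)⁻¹ * Complex.Gamma a) = 1
      by field_simp, one_smul]
  rw [h5, ← h1, Complex.Gamma_add_one _ hz2, symbolFactor, ← ha]
  have e3 : (Real.pi : ℂ) ^ ((n : ℂ) / 2 - z) =
      (Real.pi : ℂ) ^ a * (Real.pi : ℂ) ^ (-(z / 2)) / Real.pi := by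
    rw [← Complex.cpow_add _ _ hp]
    nth_rw 3 [← Complex.cpow_one (Real.pi : ℂ)]
    rw [← Complex.cpow_sub _ _ hp]
    congr 1; rw [ha]; ring
  have e4 : (Real.pi : ℂ) ^ (-(z / 2 + 1)) = (Real.pi : ℂ) ^ (-(z / 2)) / Real.pi := by
    nth_rw 3 [← Complex.cpow_one (Real.pi : ℂ)]
    rw [← Complex.cpow_sub _ _ hp]
    congr 1; ring
  rw [e3, e4]
  simp only [smul_sub, smul_smul]
  congr 2
  · field_simp
  · field_simp

end GaussianParseval

/-! ### The entire continuation of the scalar kernels -/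

section Continuation

open scoped FourierTransform LineDeriv

variable {n : ℕ} {V : Type*} [NormedAddCommGroup V] [NormedSpace ℂ V]

theorem differentiable_symbolFactor (n : ℕ) : Differentiable ℂ (symbolFactor n) := by
  have hp : (Real.pi : ℂ) ≠ 0 := by exact_mod_cast Real.pi_ne_zero
  refine Differentiable.mul (fun z => ?_) (fun z => ?_)
  · exact ((differentiableAt_const _).sub differentiableAt_id).const_cpow (Or.inl hp)
  · exact (Complex.differentiable_one_div_Gamma _).comp z
      ((((differentiableAt_const _).sub differentiableAt_id).div_const 2).add_const 1)

/-- The value at a Schwartz function of the entire family of distributions that for `0 < Re z` is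
`Γ(z/2)⁻¹ |y|^{z-n-2} y_j y_k`. For `Re z ≤ 0` it is given by its Fourier transform. -/
def rieszPairing (j k : Fin n) (F : SchwartzMap (E n) V) (z : ℂ) : V :=
  if 0 < z.re then (Complex.Gamma (z / 2))⁻¹ • normPowIntegral (z - n - 2) (mulCoord j k F)
  else symbolFactor n z • (((if j = k then (1 : ℂ) else 0) / 2) •
    normPowIntegral (-z) (𝓕⁻ F : SchwartzMap (E n) V) -
      (z / 2) • normPowIntegral (-z - 2) (mulCoord j k (𝓕⁻ F : SchwartzMap (E n) V)))

theorem rieszPairing_of_pos (j k : Fin n) (F : SchwartzMap (E n) V) {z : ℂ} (hz : 0 < z.re) :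
    rieszPairing j k F z =
      (Complex.Gamma (z / 2))⁻¹ • normPowIntegral (z - n - 2) (mulCoord j k F) :=
  if_pos hz

/-- The Fourier side is valid in the larger half plane: both expressions agree in the strip. -/
theorem rieszPairing_of_lt [CompleteSpace V] (hn : 1 ≤ n) (j k : Fin n) (F : SchwartzMap (E n) V)
    {z : ℂ} (hz : z.re < n) :
    rieszPairing j k F z = symbolFactor n z • (((if j = k then (1 : ℂ) else 0) / 2) •
      normPowIntegral (-z) (𝓕⁻ F : SchwartzMap (E n) V) -
        (z / 2) • normPowIntegral (-z - 2) (mulCoord j k (𝓕⁻ F : SchwartzMap (E n) V))) := by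
  rw [rieszPairing]
  by_cases h : 0 < z.re
  · rw [if_pos h]
    rw [← normPowIntegral_mulCoord_fourier hn h hz, FourierTransform.fourier_fourierInv_eq]
  · rw [if_neg h]

theorem differentiable_rieszPairing [CompleteSpace V] (hn : 1 ≤ n) (j k : Fin n)
    (F : SchwartzMap (E n) V) : Differentiable ℂ (rieszPairing j k F) := by
  intro z
  rcases lt_or_ge 0 z.re with hz | hz
  · have h1 : (fun w => (Complex.Gamma (w / 2))⁻¹ • normPowIntegral (w - n - 2) (mulCoord j k F))
        =ᶠ[nhds z] rieszPairing j k F := by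
      filter_upwards [(isOpen_lt_re 0).mem_nhds hz] with w hw
      exact (rieszPairing_of_pos j k F hw).symm
    refine DifferentiableAt.congr_of_eventuallyEq ?_ h1.symm
    refine DifferentiableAt.fun_smul ?_ ?_
    · exact (Complex.differentiable_one_div_Gamma _).comp z (differentiableAt_id.div_const 2)
    · refine DifferentiableAt.comp (g := fun w => normPowIntegral w (mulCoord j k F)) z
        ((differentiableOn_normPowIntegral_mulCoord hn j k F).differentiableAt
        ((isOpen_lt_re _).mem_nhds ?_)) ((differentiableAt_id.sub_const _).sub_const _)
      simp only [mem_ofPred_eq, Complex.sub_re, Complex.natCast_re, Complex.re_ofNat]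
      linarith
  · have hz' : z.re < n := lt_of_le_of_lt hz (by exact_mod_cast hn)
    have h1 : (fun w => symbolFactor n w • (((if j = k then (1 : ℂ) else 0) / 2) •
        normPowIntegral (-w) (𝓕⁻ F : SchwartzMap (E n) V) -
        (w / 2) • normPowIntegral (-w - 2) (mulCoord j k (𝓕⁻ F : SchwartzMap (E n) V))))
        =ᶠ[nhds z] rieszPairing j k F := by
      filter_upwards [(isOpen_lt Complex.continuous_re continuous_const).mem_nhds hz'] with w hw
      exact (rieszPairing_of_lt hn j k F hw).symm
    refine DifferentiableAt.congr_of_eventuallyEq ?_ h1.symm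
    refine (differentiable_symbolFactor n z).fun_smul (DifferentiableAt.fun_sub
      (DifferentiableAt.fun_const_smul ?_ _) (DifferentiableAt.fun_smul (by fun_prop) ?_))
    · refine DifferentiableAt.comp
        (g := fun w => normPowIntegral w (𝓕⁻ F : SchwartzMap (E n) V)) z
        ((differentiableOn_normPowIntegral_schwartz hn _).differentiableAt
        ((isOpen_lt_re _).mem_nhds ?_)) differentiableAt_id.neg
      simp only [mem_ofPred_eq, Complex.neg_re]
      linarith
    · refine DifferentiableAt.comp
        (g := fun w => normPowIntegral w (mulCoord j k (𝓕⁻ F : SchwartzMap (E n) V))) z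
        ((differentiableOn_normPowIntegral_mulCoord hn j k _).differentiableAt
        ((isOpen_lt_re _).mem_nhds ?_)) (differentiableAt_id.neg.sub_const _)
      simp only [mem_ofPred_eq, Complex.neg_re, Complex.sub_re, Complex.re_ofNat]
      linarith

theorem integrable_cpow_mulCoord_of_eventually_zero (j k : Fin n) (F : SchwartzMap (E n) V)
    (hF : HasCompactSupport F) (h0 : ∀ᶠ y in nhds 0, F y = 0) (w : ℂ) :
    Integrable fun y => ((‖y‖ : ℝ) : ℂ) ^ w • mulCoord j k F y := by
  refine Continuous.integrable_of_hasCompactSupport ?_ ?_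
  · refine continuous_iff_continuousAt.2 fun y => ?_
    rcases eq_or_ne y 0 with rfl | hy
    · refine ContinuousAt.congr (continuousAt_const (y := (0 : V))) ?_
      filter_upwards [h0] with y hy
      simp [mulCoord, hy]
    · refine ContinuousAt.smul ?_ (continuous_mulCoord j k F.continuous).continuousAt
      exact continuousAt_norm_cpow hy w
  · refine hF.mono' fun y hy => ?_
    refine subset_tsupport _ fun h => hy ?_
    simp [mulCoord, h]

/-- If `F` vanishes near the origin, the pairing is given by the convergent integral for all `z`. -/
theorem rieszPairing_of_eventually_zero [CompleteSpace V] (hn : 1 ≤ n) (j k : Fin n)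
    (F : SchwartzMap (E n) V) (hF : HasCompactSupport F) (h0 : ∀ᶠ y in nhds 0, F y = 0) (z : ℂ) :
    rieszPairing j k F z =
      (Complex.Gamma (z / 2))⁻¹ • normPowIntegral (z - n - 2) (mulCoord j k F) := by
  have hint := integrable_cpow_mulCoord_of_eventually_zero j k F hF h0
  have hd : Differentiable ℂ fun z => (Complex.Gamma (z / 2))⁻¹ •
      normPowIntegral (z - n - 2) (mulCoord j k F) := by
    intro z
    refine DifferentiableAt.fun_smul ?_ ?_
    · exact (Complex.differentiable_one_div_Gamma _).comp z (differentiableAt_id.div_const 2)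
    · exact DifferentiableAt.comp (g := fun w => normPowIntegral w (mulCoord j k F)) z
        ((differentiableOn_normPowIntegral hn isOpen_univ
          (continuous_mulCoord j k F.continuous).aestronglyMeasurable
          fun w _ => hint w).differentiableAt Filter.univ_mem)
        ((differentiableAt_id.sub_const _).sub_const _)
  -- both sides are entire and agree for `0 < Re z`
  have h1 : AnalyticOnNhd ℂ (rieszPairing j k F) univ := fun w _ =>
    (differentiable_rieszPairing hn j k F).analyticAt w
  have h2 : AnalyticOnNhd ℂ (fun z => (Complex.Gamma (z / 2))⁻¹ •
      normPowIntegral (z - n - 2) (mulCoord j k F)) univ := fun w _ => hd.analyticAt w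
  refine congrFun (h1.eq_of_eventuallyEq h2 (z₀ := 1) ?_) z
  filter_upwards [(isOpen_lt_re 0).mem_nhds (show (1 : ℂ) ∈ _ by simp)] with w hw
  exact rieszPairing_of_pos j k F hw

/-- The Schwartz function `y ↦ f (x - y)`. -/
def reflTranslate {f : E n → V} (hf : ContDiff ℝ ∞ f) (hc : HasCompactSupport f) (x : E n) :
    SchwartzMap (E n) V :=
  (hc.comp_homeomorph (Homeomorph.subLeft x)).toSchwartzMap
    (f := f ∘ Homeomorph.subLeft x) (hf.comp (contDiff_const.sub contDiff_id))

theorem reflTranslate_apply {f : E n → V} (hf : ContDiff ℝ ∞ f) (hc : HasCompactSupport f)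
    (x y : E n) : reflTranslate hf hc x y = f (x - y) := rfl

theorem hasCompactSupport_reflTranslate {f : E n → V} (hf : ContDiff ℝ ∞ f)
    (hc : HasCompactSupport f) (x : E n) : HasCompactSupport (reflTranslate hf hc x) :=
  hc.comp_homeomorph (Homeomorph.subLeft x)

/-- The translation by `x` becomes a character on the Fourier side. -/
theorem fourierInv_reflTranslate {f : E n → V} (hf : ContDiff ℝ ∞ f) (hc : HasCompactSupport f)
    (x w : E n) :
    (𝓕⁻ (reflTranslate hf hc x) : SchwartzMap (E n) V) w =
      Real.fourierChar ⟪w, x⟫ • 𝓕 f w := by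
  rw [SchwartzMap.fourierInv_coe, Real.fourierInv_eq, Real.fourier_eq,
    ← integral_sub_left_eq_self _ volume x, Circle.smul_def, ← integral_smul]
  refine integral_congr_ae (Filter.Eventually.of_forall fun y => ?_)
  simp only [reflTranslate_apply, sub_sub_cancel]
  rw [← Circle.smul_def, smul_smul, ← AddChar.map_add_eq_mul, inner_sub_left, real_inner_comm w x]
  rfl

theorem integrable_pow_mul_norm_cpow_smul (hn : 1 ≤ n) {w : ℂ} {m : ℕ}
    (hw : -(n : ℝ) < w.re + m) (G : SchwartzMap (E n) V) {g : E n → V}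
    (hgm : AEStronglyMeasurable g) (hg : ∀ y, ‖g y‖ ≤ ‖y‖ ^ m * ‖G y‖) (p : ℕ) :
    Integrable fun y => ‖y‖ ^ p * ‖((‖y‖ : ℝ) : ℂ) ^ w • g y‖ := by
  refine (integrable_norm_cpow_smul (w := w) (m := m + p) hn ?_ G
    (g := fun y => ((‖y‖ ^ p : ℝ) : ℂ) • g y) ?_ fun y => ?_).norm.congr
      (Filter.Eventually.of_forall fun y => ?_)
  · push_cast
    linarith [Nat.cast_nonneg (α := ℝ) p]
  · exact (by fun_prop :
      Continuous fun y : E n => ((‖y‖ ^ p : ℝ) : ℂ)).aestronglyMeasurable.smul hgm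
  · rw [norm_smul, Complex.norm_real, norm_pow, norm_norm, pow_add, mul_comm (‖y‖ ^ m), mul_assoc]
    exact mul_le_mul_of_nonneg_left (hg y) (by positivity)
  · simp only
    rw [smul_comm, norm_smul (((‖y‖ ^ p : ℝ) : ℂ)), Complex.norm_real, norm_pow, norm_norm]

theorem locallyIntegrable_norm_cpow_mul_coord (hn : 1 ≤ n) (j k : Fin n) {z : ℂ} (hz : 0 < z.re) :
    LocallyIntegrable
      (fun y : E n => ((‖y‖ : ℝ) : ℂ) ^ (z - n - 2) * ((y j * y k : ℝ) : ℂ)) := by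
  refine locallyIntegrable_of_norm_le_rpow (C := 1) (α := n - z.re) (by simpa using hn)
    (by simpa using hz) ?_ ?_
  · filter_upwards [ae_ne_zero hn] with y hy
    have hy' := norm_pos_iff.2 hy
    rw [norm_mul, norm_norm_cpow hy, one_mul, Complex.norm_real, norm_mul]
    calc ‖y‖ ^ (z - n - 2).re * (‖y j‖ * ‖y k‖) ≤ ‖y‖ ^ (z - n - 2).re * (‖y‖ * ‖y‖) := by
          gcongr <;> exact PiLp.norm_apply_le y _
      _ = ‖y‖ ^ (-(n - z.re)) := by
          rw [← sq, ← Real.rpow_natCast, ← Real.rpow_add hy']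
          congr 1
          simp
  · exact (measurable_norm_cpow _).aestronglyMeasurable.mul
      (by fun_prop : Continuous fun y : E n => ((y j * y k : ℝ) : ℂ)).aestronglyMeasurable

theorem contDiff_rieszPairing_reflTranslate [CompleteSpace V] (hn : 1 ≤ n) (j k : Fin n)
    {f : E n → V} (hf : ContDiff ℝ ∞ f) (hc : HasCompactSupport f) (z : ℂ) :
    ContDiff ℝ ∞ fun x => rieszPairing j k (reflTranslate hf hc x) z := by
  rcases lt_or_ge 0 z.re with hz | hz
  · simp only [rieszPairing_of_pos _ _ _ hz]
    refine ContDiff.const_smul _ ?_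
    have hloc := locallyIntegrable_norm_cpow_mul_coord hn j k hz
    have := hc.contDiff_convolution_right (n := (⊤ : ℕ∞))
      (ContinuousLinearMap.lsmul ℝ ℂ : ℂ →L[ℝ] V →L[ℝ] V)
      hloc hf
    convert this using 2 with x
    simp only [normPowIntegral, convolution, mulCoord, reflTranslate_apply, smul_smul,
      ContinuousLinearMap.lsmul_apply]
  · have hz' : z.re < n := lt_of_le_of_lt hz (by exact_mod_cast hn)
    simp only [rieszPairing_of_lt hn _ _ _ hz']
    -- the Fourier transform of a rapidly decreasing function is smooth
    have key : ∀ {g : E n → V},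
        (∀ m : ℕ, Integrable fun w => ‖w‖ ^ m * ‖g w‖) →
        ContDiff ℝ ∞ fun x : E n => ∫ w, Real.fourierChar ⟪w, x⟫ • g w := by
      intro g hg
      have := (Real.contDiff_fourier (N := ⊤) (f := g) fun m _ => hg m).comp
        (contDiff_neg (𝕜 := ℝ) (F := E n))
      convert this using 2 with x
      rw [Function.comp, Real.fourier_eq]
      simp
    have hF : ∀ x w, (𝓕⁻ (reflTranslate hf hc x) : SchwartzMap (E n) V) w =
      Real.fourierChar ⟪w, x⟫ • 𝓕 (hc.toSchwartzMap hf) w := fun x w =>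
        fourierInv_reflTranslate hf hc x w
    refine ContDiff.const_smul _
      (ContDiff.sub (ContDiff.const_smul _ ?_) (ContDiff.const_smul _ ?_))
    · convert key (integrable_pow_mul_norm_cpow_smul (w := -z) (m := 0) hn
        (by simpa using hz') (𝓕 (hc.toSchwartzMap hf) : SchwartzMap (E n) V)
        (g := (𝓕 (hc.toSchwartzMap hf) : SchwartzMap (E n) V))
        (SchwartzMap.continuous _).aestronglyMeasurable (by simp)) using 2 with x
      rw [normPowIntegral]
      refine integral_congr_ae (Filter.Eventually.of_forall fun w => ?_)
      simp only [hF]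
      rw [smul_comm]
    · convert key (integrable_pow_mul_norm_cpow_smul (w := -z - 2) (m := 2) hn
        (by simpa using hz') (𝓕 (hc.toSchwartzMap hf) : SchwartzMap (E n) V)
        (continuous_mulCoord j k (SchwartzMap.continuous _)).aestronglyMeasurable
        (norm_mulCoord_le j k _)) using 2 with x
      rw [normPowIntegral]
      refine integral_congr_ae (Filter.Eventually.of_forall fun w => ?_)
      simp only [hF, mulCoord]
      rw [smul_comm _ (Real.fourierChar _), smul_comm _ (Real.fourierChar _)]

/-- The partial derivative `∂f/∂x_j`. -/
def pd (j : Fin n) (f : E n → V) (x : E n) : V := fderiv ℝ f x (ek j)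

/-- The Laplacian `∑ⱼ ∂ⱼ²`, acting on each coefficient. -/
def lap (f : E n → V) (x : E n) : V := ∑ j : Fin n, pd j (pd j f) x

theorem contDiff_pd (j : Fin n) {f : E n → V} (hf : ContDiff ℝ ∞ f) : ContDiff ℝ ∞ (pd j f) :=
  ((contDiff_infty_iff_fderiv.1 hf).2).clm_apply contDiff_const

theorem contDiff_lap {f : E n → V} (hf : ContDiff ℝ ∞ f) : ContDiff ℝ ∞ (lap f) :=
  ContDiff.sum fun j _ => contDiff_pd j (contDiff_pd j hf)

theorem hasCompactSupport_pd (j : Fin n) {f : E n → V} (hc : HasCompactSupport f) :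
    HasCompactSupport (pd j f) := hc.fderiv_apply (𝕜 := ℝ) (ek j)

theorem hasCompactSupport_lap {f : E n → V} (hc : HasCompactSupport f) :
    HasCompactSupport (lap f) := by
  have h : lap f = ∑ j : Fin n, pd j (pd j f) := by
    ext x
    simp [lap]
  rw [h]
  exact Finset.sum_induction _ HasCompactSupport (fun _ _ => HasCompactSupport.add)
    HasCompactSupport.zero fun j _ => hasCompactSupport_pd j (hasCompactSupport_pd j hc)

theorem contDiff_lap_iterate {f : E n → V} (hf : ContDiff ℝ ∞ f) (m : ℕ) :
    ContDiff ℝ ∞ (lap^[m] f) := by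
  induction m with
  | zero => exact hf
  | succ m ih => rw [Function.iterate_succ_apply']; exact contDiff_lap ih

theorem hasCompactSupport_lap_iterate {f : E n → V} (hc : HasCompactSupport f) (m : ℕ) :
    HasCompactSupport (lap^[m] f) := by
  induction m with
  | zero => exact hc
  | succ m ih => rw [Function.iterate_succ_apply']; exact hasCompactSupport_lap ih

theorem fourier_pd {f : E n → V} (hf : ContDiff ℝ ∞ f) (hc : HasCompactSupport f) (j : Fin n)
    (w : E n) : 𝓕 (pd j f) w = (2 * Real.pi * Complex.I * w j) • 𝓕 f w :=
  fourier_lineDeriv_ek_apply (hc.toSchwartzMap hf) j w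

theorem fourier_pd_pd {f : E n → V} (hf : ContDiff ℝ ∞ f) (hc : HasCompactSupport f) (j k : Fin n)
    (w : E n) :
    𝓕 (pd j (pd k f)) w = (-(4 * Real.pi ^ 2 : ℂ)) • ((w j * w k : ℝ) : ℂ) • 𝓕 f w := by
  rw [fourier_pd (contDiff_pd k hf) (hasCompactSupport_pd k hc), fourier_pd hf hc, smul_smul,
    smul_smul]
  congr 1
  push_cast
  linear_combination (4 * Real.pi ^ 2 * w j * w k : ℂ) * Complex.I_sq

theorem fourier_lap {f : E n → V} (hf : ContDiff ℝ ∞ f) (hc : HasCompactSupport f) (w : E n) :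
    𝓕 (lap f) w = (-(4 * Real.pi ^ 2 : ℂ) * (‖w‖ : ℂ) ^ 2) • 𝓕 f w := by
  have h1 : 𝓕 (lap f) w = ∑ j : Fin n, 𝓕 (pd j (pd j f)) w := by
    simp only [Real.fourier_eq, lap, Finset.smul_sum]
    refine integral_finsetSum _ fun j _ => ?_
    refine (Real.fourierIntegral_convergent_iff w).2 ?_
    exact (contDiff_pd j (contDiff_pd j hf)).continuous.integrable_of_hasCompactSupport
      (hasCompactSupport_pd j (hasCompactSupport_pd j hc))
  rw [h1]
  simp only [fourier_pd_pd hf hc]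
  rw [← Finset.smul_sum, ← Finset.sum_smul, smul_smul]
  congr 2
  rw [← Complex.ofReal_pow, EuclideanSpace.real_norm_sq_eq]
  push_cast
  simp only [sq]

theorem fourier_lap_iterate {f : E n → V} (hf : ContDiff ℝ ∞ f) (hc : HasCompactSupport f) (m : ℕ)
    (w : E n) :
    𝓕 (lap^[m] f) w = (-(4 * Real.pi ^ 2 : ℂ) * (‖w‖ : ℂ) ^ 2) ^ m • 𝓕 f w := by
  induction m with
  | zero => simp
  | succ m ih =>
    rw [Function.iterate_succ_apply', fourier_lap (contDiff_lap_iterate hf m)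
      (hasCompactSupport_lap_iterate hc m), ih, smul_smul,
      ← pow_succ']

/-- Fourier inversion at the origin. -/
theorem integral_fourierInv_reflTranslate [CompleteSpace V] {f : E n → V} (hf : ContDiff ℝ ∞ f)
    (hc : HasCompactSupport f) (x : E n) :
    ∫ w, (𝓕⁻ (reflTranslate hf hc x) : SchwartzMap (E n) V) w = f x := by
  have h1 : (𝓕 (𝓕⁻ (reflTranslate hf hc x) : SchwartzMap (E n) V) : SchwartzMap (E n) V) 0 =
      f x := by
    rw [FourierTransform.fourier_fourierInv_eq, reflTranslate_apply, sub_zero]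
  rw [← h1, SchwartzMap.fourier_coe, Real.fourier_eq]
  simp

/-- Even powers of the norm on the Fourier side are powers of the Laplacian. -/
theorem normPowIntegral_fourierInv_even [CompleteSpace V] {f : E n → V} (hf : ContDiff ℝ ∞ f)
    (hc : HasCompactSupport f) (m : ℕ) (x : E n) :
    normPowIntegral (2 * m : ℂ) (𝓕⁻ (reflTranslate hf hc x) : SchwartzMap (E n) V) =
      ((-(4 * Real.pi ^ 2 : ℂ)) ^ m)⁻¹ • lap^[m] f x := by
  have hp : (-(4 * Real.pi ^ 2 : ℂ)) ^ m ≠ 0 := by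
    have : (Real.pi : ℂ) ≠ 0 := by exact_mod_cast Real.pi_ne_zero
    exact pow_ne_zero _ (neg_ne_zero.2 (mul_ne_zero (by norm_num) (pow_ne_zero _ this)))
  rw [eq_inv_smul_iff₀ hp, ← integral_fourierInv_reflTranslate (contDiff_lap_iterate hf m)
    (hasCompactSupport_lap_iterate hc m), normPowIntegral, ← integral_smul]
  refine integral_congr_ae (Filter.Eventually.of_forall fun w => ?_)
  simp only [fourierInv_reflTranslate, fourier_lap_iterate hf hc]
  rw [smul_comm _ (Real.fourierChar _), smul_comm _ (Real.fourierChar _), smul_smul, mul_pow,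
    ← pow_mul, show (2 * m : ℂ) = ((2 * m : ℕ) : ℂ) by push_cast; ring, Complex.cpow_natCast]

theorem normPowIntegral_mulCoord_fourierInv_even [CompleteSpace V] {f : E n → V}
    (hf : ContDiff ℝ ∞ f) (hc : HasCompactSupport f) (j k : Fin n) (m : ℕ) (x : E n) :
    normPowIntegral (2 * m : ℂ)
        (mulCoord j k (𝓕⁻ (reflTranslate hf hc x) : SchwartzMap (E n) V)) =
      ((-(4 * Real.pi ^ 2 : ℂ)) ^ (m + 1))⁻¹ • pd j (pd k (lap^[m] f)) x := by
  have hp : (-(4 * Real.pi ^ 2 : ℂ)) ^ (m + 1) ≠ 0 := by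
    have : (Real.pi : ℂ) ≠ 0 := by exact_mod_cast Real.pi_ne_zero
    exact pow_ne_zero _ (neg_ne_zero.2 (mul_ne_zero (by norm_num) (pow_ne_zero _ this)))
  have hf' := contDiff_lap_iterate hf m
  have hc' := hasCompactSupport_lap_iterate hc m
  rw [eq_inv_smul_iff₀ hp, ← integral_fourierInv_reflTranslate
    (contDiff_pd j (contDiff_pd k hf')) (hasCompactSupport_pd j (hasCompactSupport_pd k hc')),
    normPowIntegral, ← integral_smul]
  refine integral_congr_ae (Filter.Eventually.of_forall fun w => ?_)
  simp only [mulCoord, fourierInv_reflTranslate, fourier_pd_pd hf' hc', fourier_lap_iterate hf hc]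
  simp only [smul_comm _ (Real.fourierChar _), smul_smul]
  rw [show (2 * m : ℂ) = ((2 * m : ℕ) : ℂ) by push_cast; ring, Complex.cpow_natCast]
  congr 2
  rw [mul_pow, ← pow_mul]
  ring

theorem symbolFactor_neg_even (n l : ℕ) :
    symbolFactor n (-(2 * l)) =
      ((Real.pi ^ ((n : ℝ) / 2) / Real.Gamma ((n : ℝ) / 2 + l + 1) : ℝ) : ℂ) *
        (Real.pi : ℂ) ^ (2 * l) := by
  have hp : (Real.pi : ℂ) ≠ 0 := by exact_mod_cast Real.pi_ne_zero
  rw [symbolFactor, show (n : ℂ) / 2 - -(2 * l) = n / 2 + (2 * l : ℕ) by push_cast; ring,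
    Complex.cpow_add _ _ hp, Complex.cpow_natCast, Complex.ofReal_div,
    Complex.ofReal_cpow Real.pi_pos.le, ← Complex.Gamma_ofReal]
  push_cast
  rw [show ((n : ℂ) - -(2 * l)) / 2 + 1 = n / 2 + l + 1 by ring]
  ring

/-- At `z = 0` the continued kernel is a multiple of the Dirac measure. -/
theorem rieszPairing_zero [CompleteSpace V] (hn : 1 ≤ n) (j k : Fin n) {f : E n → V}
    (hf : ContDiff ℝ ∞ f) (hc : HasCompactSupport f) (x : E n) :
    rieszPairing j k (reflTranslate hf hc x) 0 =
      (symbolFactor n 0 * ((if j = k then (1 : ℂ) else 0) / 2)) • f x := by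
  have h := normPowIntegral_fourierInv_even hf hc 0 x
  simp only [Nat.cast_zero, mul_zero, pow_zero, inv_one, one_smul, Function.iterate_zero, id] at h
  rw [rieszPairing_of_lt hn _ _ _ (by simpa using Nat.pos_of_ne_zero (by lia)), neg_zero, h,
    zero_div, zero_smul, sub_zero, smul_smul]

/-- At `z = -2l` the continued kernel is a differential operator applied to the Dirac measure. -/
theorem rieszPairing_neg_even [CompleteSpace V] (hn : 1 ≤ n) (j k : Fin n) {f : E n → V}
    (hf : ContDiff ℝ ∞ f) (hc : HasCompactSupport f) (m : ℕ) (x : E n) :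
    rieszPairing j k (reflTranslate hf hc x) (-(2 * (m + 1 : ℕ))) =
      (((-1) ^ (m + 1) * Real.pi ^ ((n : ℝ) / 2) /
        (2 ^ (2 * (m + 1)) * Real.Gamma ((n : ℝ) / 2 + (m + 1 : ℕ) + 1)) : ℝ) : ℂ) •
        (((if j = k then (1 : ℂ) else 0) / 2) • lap^[m + 1] f x +
          ((m + 1 : ℕ) : ℂ) • pd j (pd k (lap^[m] f)) x) := by
  have hp : (Real.pi : ℂ) ≠ 0 := by exact_mod_cast Real.pi_ne_zero
  have hn0 : (0 : ℝ) < n := by exact_mod_cast hn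
  rw [rieszPairing_of_lt hn _ _ _ (by simp; linarith [Nat.cast_nonneg (α := ℝ) m]), neg_neg,
    show (2 * (m + 1 : ℕ) - 2 : ℂ) = 2 * m by push_cast; ring,
    normPowIntegral_fourierInv_even, normPowIntegral_mulCoord_fourierInv_even,
    show -(2 * ((m + 1 : ℕ) : ℂ)) / 2 = -((m + 1 : ℕ) : ℂ) by ring, neg_smul, sub_neg_eq_add,
    symbolFactor_neg_even, smul_comm _ ((_ : ℂ)⁻¹), smul_comm _ ((_ : ℂ)⁻¹), ← smul_add, smul_smul]
  congr 1
  rw [show (-(4 * Real.pi ^ 2 : ℂ)) ^ (m + 1) =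
    (-1) ^ (m + 1) * 2 ^ (2 * (m + 1)) * (Real.pi : ℂ) ^ (2 * (m + 1)) by
      rw [pow_mul, pow_mul, ← mul_pow, ← mul_pow]; congr 1; ring]
  push_cast
  have h1 : ((-1 : ℂ) ^ (m + 1))⁻¹ = (-1) ^ (m + 1) := by
    rw [← inv_pow]; norm_num
  rw [mul_inv, mul_inv, h1]
  field_simp

end Continuation

/-! ### The reflection representation on forms -/

section Algebra

variable {n i : ℕ}

theorem sum_coord_smul_ek (y : E n) : ∑ k : Fin n, y k • (ek k : E n) = y := by
  ext j
  simp [Finset.sum_apply, Pi.single_apply]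

/-- Perturbing all arguments of an alternating form along a common vector `x` is an affine
operation: two arguments proportional to `x` make the form vanish. -/
theorem form_map_add_smul (u : Form n i) (v : Fin i → E n) (c : Fin i → ℝ) (x : E n) :
    u (fun p => v p + c p • x) = u v + ∑ p, c p • u (Function.update v p x) := by
  -- the perturbation is made in the arguments of a finite set `s`, by induction on `s`
  have key : ∀ (s : Finset (Fin i)) (v : Fin i → E n),
      u (fun p => if p ∈ s then v p + c p • x else v p) =
        u v + ∑ p ∈ s, c p • u (Function.update v p x) := by
    intro s
    induction s using Finset.induction_on with
    | empty => intro v; simp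
    | insert q s hq ih =>
      intro v
      set w : Fin i → E n := fun p => if p ∈ s then v p + c p • x else v p with hw
      have h1 : (fun p => if p ∈ insert q s then v p + c p • x else v p) =
          Function.update w q (v q + c q • x) := by
        funext p
        by_cases hp : p = q
        · subst hp; simp
        · simp [hp, hw]
      have h2 : Function.update w q (v q) = w := by
        funext p
        by_cases hp : p = q
        · subst hp; simp [hw, hq]
        · simp [hp]
      have h3 : Function.update w q x =
          fun p => if p ∈ s then Function.update v q x p + c p • x
            else Function.update v q x p := by
        funext p
        by_cases hp : p = q
        · subst hp; simp [hq]
        · simp [hp, hw]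
      -- `x` would stand in two places
      have h4 : ∀ p ∈ s, c p • u (Function.update (Function.update v q x) p x) = 0 := by
        intro p hp
        have hpq : p ≠ q := fun h => hq (h ▸ hp)
        rw [u.map_eq_zero_of_eq _ (i := p) (j := q) (by simp [hpq.symm]) hpq, smul_zero]
      rw [h1, u.map_update_add, h2, u.map_update_smul, h3, ih, ih, Finset.sum_eq_zero h4, add_zero,
        Finset.sum_insert hq, add_assoc, add_comm (∑ p ∈ s, _)]
  have := key Finset.univ v
  simpa using this

/-- The contraction `ι_e` of forms by a vector `e`. -/
def contractCLM (e : E n) : Form n (i + 1) →L[ℝ] Form n i :=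
  (ContinuousLinearMap.apply ℝ (Form n i) e).comp
    ContinuousAlternatingMap.curryLeftLI.toContinuousLinearMap

theorem contractCLM_apply (e : E n) (u : Form n (i + 1)) : contractCLM e u = u.curryLeft e := rfl

/-- The endomorphism `e_j ∧ ι_k` of `⋀ⁱ(ℂⁿ)`, which is zero in degree `0`. The exterior product with
`e_j` is the alternatization of `v ↦ v_j u`, without a factorial factor. -/
def wedgeContr (j k : Fin n) : {i : ℕ} → Form n i →L[ℂ] Form n i
  | 0 => 0
  | i + 1 =>
    { toFun := fun u => ContinuousAlternatingMap.alternatizeUncurryFin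
        ((EuclideanSpace.proj (𝕜 := ℝ) j : E n →L[ℝ] ℝ).smulRight (u.curryLeft (ek k)))
      map_add' := fun u v => by
        ext w
        simp [ContinuousAlternatingMap.alternatizeUncurryFin_apply, Finset.sum_add_distrib]
      map_smul' := fun c u => by
        ext w
        simp [ContinuousAlternatingMap.alternatizeUncurryFin_apply, Finset.mul_sum]
        refine Finset.sum_congr rfl fun p _ => by ring
      cont := (ContinuousAlternatingMap.alternatizeUncurryFinCLM ℝ (E n) ℂ).continuous.comp
        ((ContinuousLinearMap.smulRightL ℝ (E n) (Form n i)
          (EuclideanSpace.proj (𝕜 := ℝ) j : E n →L[ℝ] ℝ)).continuous.comp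
            (contractCLM (ek k)).continuous) }

theorem wedgeContr_apply (j k : Fin n) (u : Form n i) (v : Fin i → E n) :
    wedgeContr j k u v = ∑ p, v p j • u (Function.update v p (ek k)) := by
  cases i with
  | zero => simp [wedgeContr]
  | succ i =>
    change ContinuousAlternatingMap.alternatizeUncurryFin _ v = _
    rw [ContinuousAlternatingMap.alternatizeUncurryFin_apply]
    refine Finset.sum_congr rfl fun p _ => ?_
    rw [← Fin.insertNth_removeNth, u.map_insertNth]
    simp [ContinuousAlternatingMap.curryLeft_apply_apply]
    ring

theorem form_update_eq_sum (u : Form n i) (v : Fin i → E n) (p : Fin i) (y : E n) :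
    u (Function.update v p y) = ∑ k, y k • u (Function.update v p (ek k)) := by
  conv_lhs => rw [← sum_coord_smul_ek y]
  rw [← ContinuousAlternatingMap.coe_toAlternatingMap, AlternatingMap.map_update_sum]
  simp

/-- The sum of the `e_j ∧ ι_j` is the degree. -/
theorem sum_wedgeContr_self (u : Form n i) : ∑ j : Fin n, wedgeContr j j u = (i : ℂ) • u := by
  ext v
  rw [ContinuousAlternatingMap.sum_apply]
  simp only [wedgeContr_apply]
  rw [Finset.sum_comm]
  simp only [← form_update_eq_sum, Function.update_eq_self]
  simp

/-- The coefficient `δ_jk - 2 e_j ∧ ι_k` of `y_j y_k` in `|y|² σ(ψ(y))`. -/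
def reflCoeff (j k : Fin n) : Form n i →L[ℂ] Form n i :=
  (if j = k then (1 : ℂ) else 0) • ContinuousLinearMap.id ℂ (Form n i) - (2 : ℂ) • wedgeContr j k

theorem reflCoeff_apply (j k : Fin n) (u : Form n i) :
    reflCoeff j k u = (if j = k then (1 : ℂ) else 0) • u - (2 : ℂ) • wedgeContr j k u := rfl

/-- `σ(ψ(y))` is a quadratic expression in `y`, up to the factor `|y|²`. -/
theorem sigma_psi_apply {y : E n} (hy : y ≠ 0) (u : Form n i) :
    sigma i (psi y) u =
      ((‖y‖ : ℂ) ^ 2)⁻¹ • ∑ j : Fin n, ∑ k : Fin n, ((y j * y k : ℝ) : ℂ) • reflCoeff j k u := by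
  have hy' : (‖y‖ : ℂ) ≠ 0 := by simpa using hy
  rw [eq_inv_smul_iff₀ (pow_ne_zero 2 hy')]
  ext v
  have h1 : sigma i (psi y) u v = u (fun p => v p + (-(2 * ⟪y, v p⟫ / ‖y‖ ^ 2)) • y) := by
    change u (fun p => psi y (v p)) = _
    congr 1
    funext p
    rw [psi_apply, neg_smul, sub_eq_add_neg]
  have h2 : ∀ p, ⟪y, v p⟫ = ∑ j, y j * v p j := fun p => by
    simp [PiLp.inner_apply, mul_comm]
  rw [ContinuousAlternatingMap.smul_apply, h1, form_map_add_smul]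
  simp only [ContinuousAlternatingMap.sum_apply, ContinuousAlternatingMap.smul_apply,
    reflCoeff_apply, ContinuousAlternatingMap.sub_apply, smul_sub, Finset.sum_sub_distrib,
    wedgeContr_apply]
  rw [smul_add, sub_eq_add_neg]
  congr 1
  · rw [← Complex.ofReal_pow, EuclideanSpace.real_norm_sq_eq]
    simp [Finset.sum_mul, sq]
  · simp only [form_update_eq_sum u v _ y, h2]
    have e1 : ∀ p, ((‖y‖ : ℂ) ^ 2) •
        (-(2 * ∑ j, y j * v p j) / ‖y‖ ^ 2) • ∑ k, y k • u (Function.update v p (ek k)) =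
        -∑ j, ∑ k, ((y j * y k : ℝ) : ℂ) • (2 : ℂ) • v p j • u (Function.update v p (ek k)) := by
      intro p
      simp only [Complex.real_smul, smul_eq_mul, ← Finset.mul_sum, Complex.ofReal_mul, mul_assoc]
      push_cast
      rw [← mul_assoc, mul_div_cancel₀ _ (pow_ne_zero 2 hy'), neg_mul]
      congr 1
      simp only [Finset.mul_sum, Finset.sum_mul]
      rw [Finset.sum_comm]
      refine Finset.sum_congr rfl fun j _ => Finset.sum_congr rfl fun k _ => by ring
    rw [Finset.smul_sum, ← Finset.sum_neg_distrib]
    simp only [← neg_div] at e1 ⊢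
    rw [Finset.sum_congr rfl fun p _ => e1 p]
    rw [Finset.sum_neg_distrib, Finset.sum_neg_distrib, Finset.sum_comm]
    congr 1
    refine Finset.sum_congr rfl fun j _ => ?_
    rw [Finset.sum_comm]
    simp only [Finset.smul_sum]

end Algebra

/-! ### The Laplacian and Branson's operator in coordinates -/

section FormOperators

variable {n i : ℕ}

theorem differentiable_of_contDiff {V : Type*} [NormedAddCommGroup V] [NormedSpace ℝ V]
    {u : E n → V} (hu : ContDiff ℝ ∞ u) : Differentiable ℝ u := hu.differentiable (by simp)

theorem clm_eq_sum_proj {V : Type*} [NormedAddCommGroup V] [NormedSpace ℝ V] (D : E n →L[ℝ] V) :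
    D = ∑ j : Fin n, (EuclideanSpace.proj (𝕜 := ℝ) j : E n →L[ℝ] ℝ).smulRight (D (ek j)) := by
  ext e
  conv_lhs => rw [← sum_coord_smul_ek e]
  simp

theorem pd_comm {V : Type*} [NormedAddCommGroup V] [NormedSpace ℂ V] {u : E n → V}
    (hu : ContDiff ℝ ∞ u) (j k : Fin n) (x : E n) :
    pd j (pd k u) x = pd k (pd j u) x := by
  have hd : DifferentiableAt ℝ (fderiv ℝ u) x :=
    differentiable_of_contDiff (contDiff_infty_iff_fderiv.1 hu).2 x
  have h : ∀ a b : Fin n, pd a (pd b u) x = fderiv ℝ (fderiv ℝ u) x (ek a) (ek b) := by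
    intro a b
    change fderiv ℝ (fun y => fderiv ℝ u y (ek b)) x (ek a) = _
    rw [fderiv_clm_apply hd (differentiableAt_const _)]
    simp
  rw [h, h]
  exact (hu.contDiffAt.isSymmSndFDerivAt
    (by simpa using WithTop.coe_le_coe.2 (le_top : (2 : ℕ∞) ≤ ⊤))) _ _

theorem fderiv_clm_comp {V W : Type*} [NormedAddCommGroup V] [NormedSpace ℝ V]
    [NormedAddCommGroup W] [NormedSpace ℝ W] (A : V →L[ℝ] W) {u : E n → V} (hu : ContDiff ℝ ∞ u)
    (x : E n) : fderiv ℝ (fun y => A (u y)) x = A.comp (fderiv ℝ u x) :=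
  (A.hasFDerivAt.comp x (differentiable_of_contDiff hu x).hasFDerivAt).fderiv

theorem pd_clm_comp {V W : Type*} [NormedAddCommGroup V] [NormedSpace ℂ V]
    [NormedAddCommGroup W] [NormedSpace ℂ W] (A : V →L[ℝ] W) {u : E n → V} (hu : ContDiff ℝ ∞ u)
    (j : Fin n) : pd j (fun y => A (u y)) = fun x => A (pd j u x) := by
  funext x
  simp only [pd]
  rw [fderiv_clm_comp A hu x]
  rfl

/-- The exterior product `e_j ∧ d`. -/
def wedgeCLM (j : Fin n) : Form n i →L[ℝ] Form n (i + 1) :=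
  (ContinuousAlternatingMap.alternatizeUncurryFinCLM ℝ (E n) ℂ).comp
    (ContinuousLinearMap.smulRightL ℝ (E n) (Form n i)
      (EuclideanSpace.proj (𝕜 := ℝ) j : E n →L[ℝ] ℝ))

theorem wedgeCLM_apply (j : Fin n) (d : Form n i) :
    wedgeCLM j d = ContinuousAlternatingMap.alternatizeUncurryFin
      ((EuclideanSpace.proj (𝕜 := ℝ) j : E n →L[ℝ] ℝ).smulRight d) := rfl

theorem wedgeCLM_contractCLM (j k : Fin n) (u : Form n (i + 1)) :
    wedgeCLM j (contractCLM (ek k) u) = wedgeContr j k u := rfl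

theorem alternatize_eq_sum (D : E n →L[ℝ] Form n i) :
    ContinuousAlternatingMap.alternatizeUncurryFin D = ∑ j, wedgeCLM j (D (ek j)) := by
  conv_lhs => rw [clm_eq_sum_proj D]
  rw [← ContinuousAlternatingMap.alternatizeUncurryFinCLM_apply, map_sum]
  rfl

/-- The anticommutation relation `ι_k (e_j ∧ d) + e_j ∧ ι_k d = δ_jk d`. -/
theorem contractCLM_wedgeCLM (j k : Fin n) (d : Form n i) :
    contractCLM (ek k) (wedgeCLM j d) = (if j = k then (1 : ℂ) else 0) • d - wedgeContr j k d := by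
  ext v
  rw [contractCLM_apply, ContinuousAlternatingMap.curryLeft_apply_apply, wedgeCLM_apply,
    ContinuousAlternatingMap.alternatizeUncurryFin_apply, Fin.sum_univ_succ,
    ContinuousAlternatingMap.sub_apply, wedgeContr_apply, sub_eq_add_neg,
    ← Finset.sum_neg_distrib]
  congr 1
  · simp [Fin.removeNth_zero]
  · refine Finset.sum_congr rfl fun q _ => ?_
    cases i with
    | zero => exact q.elim0
    | succ i =>
      rw [← Fin.insertNth_removeNth, d.map_insertNth]
      have h : (Fin.succ q).removeNth (Matrix.vecCons (ek k) v) =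
          Matrix.vecCons (ek k : E n) (q.removeNth v) := by
        funext r
        refine Fin.cases ?_ (fun r => ?_) r <;> simp [Fin.removeNth]
      rw [h]
      simp [pow_succ]
      ring

theorem extDeriv_eq_sum (u : E n → Form n i) (x : E n) :
    extDeriv u x = ∑ j, wedgeCLM j (pd j u x) := alternatize_eq_sum _

theorem codiff_eq_sum (u : E n → Form n (i + 1)) (x : E n) :
    codiff u x = -∑ k, contractCLM (ek k) (pd k u x) := rfl

theorem pd_sum {V : Type*} [NormedAddCommGroup V] [NormedSpace ℂ V] {ι : Type*} (s : Finset ι)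
    {u : ι → E n → V} (hu : ∀ a, ContDiff ℝ ∞ (u a)) (j : Fin n) :
    pd j (fun x => ∑ a ∈ s, u a x) = fun x => ∑ a ∈ s, pd j (u a) x := by
  funext x
  simp only [pd]
  rw [fderiv_fun_sum fun a _ => differentiable_of_contDiff (hu a) x]
  simp

theorem dCodiff_eq {u : E n → Form n i} (hu : ContDiff ℝ ∞ u) (x : E n) :
    dCodiff u x = -∑ j, ∑ k, wedgeContr j k (pd j (pd k u) x) := by
  cases i with
  | zero => simp [dCodiff, wedgeContr]
  | succ i =>
    have h1 : codiff u = fun y => ∑ k, (-contractCLM (ek k)) (pd k u y) := by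
      funext y
      rw [codiff_eq_sum, ← Finset.sum_neg_distrib]
      rfl
    change extDeriv (codiff u) x = _
    rw [extDeriv_eq_sum, h1, ← Finset.sum_neg_distrib]
    refine Finset.sum_congr rfl fun j _ => ?_
    rw [pd_sum Finset.univ (u := fun k y => (-contractCLM (ek k)) (pd k u y))
      (fun k => (-contractCLM (ek k)).contDiff.comp (contDiff_pd k hu))]
    simp only [pd_clm_comp _ (contDiff_pd _ hu)]
    rw [map_sum, ← Finset.sum_neg_distrib]
    refine Finset.sum_congr rfl fun k _ => ?_
    rw [← wedgeCLM_contractCLM, neg_apply, map_neg]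

/-- The flat Weitzenböck identity: `d* d + d d*` is minus the coordinatewise Laplacian. -/
theorem codiffD_eq {u : E n → Form n i} (hu : ContDiff ℝ ∞ u) (x : E n) :
    codiffD u x = -lap u x - dCodiff u x := by
  have h1 : extDeriv u = fun y => ∑ j, wedgeCLM j (pd j u y) := funext (extDeriv_eq_sum u)
  have h2 : ∀ k, contractCLM (ek k) (pd k (fun y => ∑ j, wedgeCLM j (pd j u y)) x) =
      pd k (pd k u) x - ∑ j, wedgeContr j k (pd j (pd k u) x) := by
    intro k
    rw [pd_sum Finset.univ (u := fun j y => wedgeCLM j (pd j u y))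
      (fun j => (wedgeCLM j).contDiff.comp (contDiff_pd j hu))]
    simp only [pd_clm_comp _ (contDiff_pd _ hu)]
    rw [map_sum]
    simp only [contractCLM_wedgeCLM, Finset.sum_sub_distrib, pd_comm hu k]
    simp
  rw [codiffD, codiff_eq_sum, h1, dCodiff_eq hu, lap]
  simp only [h2]
  rw [Finset.sum_sub_distrib, Finset.sum_comm (γ := Fin n)]
  abel

theorem laplace_eq {u : E n → Form n i} (hu : ContDiff ℝ ∞ u) : laplace u = lap u := by
  funext x
  simp only [laplace, Pi.neg_apply, Pi.add_apply, codiffD_eq hu]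
  abel

theorem laplace_iterate_eq {u : E n → Form n i} (hu : ContDiff ℝ ∞ u) (m : ℕ) :
    laplace^[m] u = lap^[m] u := by
  induction m with
  | zero => rfl
  | succ m ih =>
    rw [Function.iterate_succ_apply', Function.iterate_succ_apply', ih,
      laplace_eq (contDiff_lap_iterate hu m)]

theorem branson_succ_apply {u : E n → Form n i} (hu : ContDiff ℝ ∞ u) (m : ℕ) (x : E n) :
    branson (m + 1) u x = -(((n : ℂ) / 2 - i + (m + 1 : ℕ)) • lap^[m + 1] u x) +
      (2 * (m + 1 : ℕ) : ℂ) • ∑ j, ∑ k, wedgeContr j k (pd j (pd k (lap^[m] u)) x) := by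
  have hu' := contDiff_lap_iterate hu m
  simp only [branson, laplace_iterate_eq hu, Pi.add_apply, Pi.smul_apply, Pi.sub_apply,
    codiffD_eq hu', dCodiff_eq hu']
  rw [← Function.iterate_succ_apply' lap m u]
  module

end FormOperators

/-! ### Differential operators with constant coefficients -/

section ConstantCoefficients

variable {n i : ℕ}

/-- `T` is a differential operator with constant coefficients on test forms. -/
def IsConstCoeffOperator (T : (E n → Form n i) → (E n → Form n i)) : Prop :=
  ∃ (N : ℕ) (a : (k : ℕ) → (Fin k → Fin n) → (Form n i →L[ℂ] Form n i)),
    ∀ f : E n → Form n i, IsTestForm f → ∀ x : E n,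
      T f x = ∑ k ∈ Finset.range (N + 1), ∑ w : Fin k → Fin n,
        a k w (iteratedFDeriv ℝ k f x (fun j => ek (w j)))

namespace IsConstCoeffOperator

variable {T T' : (E n → Form n i) → (E n → Form n i)}

theorem isDifferentialOperator (h : IsConstCoeffOperator T) : IsDifferentialOperator T := by
  obtain ⟨N, a, ha⟩ := h
  exact ⟨N, fun k w _ => (a k w).toLinearMap, fun _ _ _ => contDiff_const, ha⟩

theorem congr (h : IsConstCoeffOperator T) (hT : ∀ f, IsTestForm f → T' f = T f) :
    IsConstCoeffOperator T' := by
  obtain ⟨N, a, ha⟩ := h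
  exact ⟨N, a, fun f hf x => by rw [hT f hf, ha f hf x]⟩

theorem id : IsConstCoeffOperator (fun f : E n → Form n i => f) :=
  ⟨0, fun _ _ => ContinuousLinearMap.id ℂ _, fun f _ x => by simp⟩

theorem zero : IsConstCoeffOperator (fun (_ : E n → Form n i) => (0 : E n → Form n i)) :=
  ⟨0, fun _ _ => 0, fun f _ x => by simp⟩

theorem comp_left (A : Form n i →L[ℂ] Form n i) (h : IsConstCoeffOperator T) :
    IsConstCoeffOperator (fun f x => A (T f x)) := by
  obtain ⟨N, a, ha⟩ := h
  exact ⟨N, fun k w => A.comp (a k w), fun f hf x => by simp [ha f hf x, map_sum]⟩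

/-- The order may be raised by coefficients equal to zero. -/
theorem exists_order_le {N : ℕ} {a : (k : ℕ) → (Fin k → Fin n) → (Form n i →L[ℂ] Form n i)}
    (ha : ∀ f : E n → Form n i, IsTestForm f → ∀ x : E n,
      T f x = ∑ k ∈ Finset.range (N + 1), ∑ w : Fin k → Fin n,
        a k w (iteratedFDeriv ℝ k f x (fun j => ek (w j)))) {M : ℕ} (hM : N ≤ M) :
    ∃ b : (k : ℕ) → (Fin k → Fin n) → (Form n i →L[ℂ] Form n i),
    ∀ f : E n → Form n i, IsTestForm f → ∀ x : E n,
      T f x = ∑ k ∈ Finset.range (M + 1), ∑ w : Fin k → Fin n,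
        b k w (iteratedFDeriv ℝ k f x (fun j => ek (w j))) := by
  refine ⟨fun k w => if k < N + 1 then a k w else 0, fun f hf x => ?_⟩
  rw [ha f hf x]
  have hsub : Finset.range (N + 1) ⊆ Finset.range (M + 1) := Finset.range_mono (by lia)
  rw [← Finset.sum_subset hsub]
  · refine Finset.sum_congr rfl fun k hk => ?_
    simp [Finset.mem_range.1 hk]
  · intro k _ hk
    simp only [Finset.mem_range] at hk
    simp [hk]

theorem add (h : IsConstCoeffOperator T) (h' : IsConstCoeffOperator T') :
    IsConstCoeffOperator (fun f x => T f x + T' f x) := by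
  obtain ⟨N, a, ha⟩ := h
  obtain ⟨N', a', ha'⟩ := h'
  obtain ⟨b, hb⟩ := exists_order_le ha (le_max_left N N')
  obtain ⟨b', hb'⟩ := exists_order_le ha' (le_max_right N N')
  refine ⟨max N N', fun k w => b k w + b' k w, fun f hf x => ?_⟩
  change T f x + T' f x = _
  rw [hb f hf x, hb' f hf x]
  simp [Finset.sum_add_distrib]

theorem sum {ι : Type*} (s : Finset ι) {T : ι → (E n → Form n i) → (E n → Form n i)}
    (h : ∀ a, IsConstCoeffOperator (T a)) :
    IsConstCoeffOperator (fun f x => ∑ a ∈ s, T a f x) := by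
  classical
  induction s using Finset.induction_on with
  | empty => exact zero.congr fun f _ => by ext; simp
  | insert b s hb ih =>
    exact ((h b).add ih).congr fun f _ => by ext1 x; rw [Finset.sum_insert hb]

theorem pd_comp (j : Fin n) (h : IsConstCoeffOperator T) :
    IsConstCoeffOperator (fun f => pd j (T f)) := by
  obtain ⟨N, a, ha⟩ := h
  -- the derivative `∂_j` is prepended to each word
  refine ⟨N + 1, fun k => match k with
    | 0 => fun _ => 0
    | k + 1 => fun w => if w 0 = j then a k (Fin.tail w) else 0, fun f hf x => ?_⟩
  have hdiff : ∀ (k : ℕ) (w : Fin k → Fin n) (y : E n), HasFDerivAt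
      (fun y => a k w (iteratedFDeriv ℝ k f y (fun j => ek (w j))))
      (((a k w).restrictScalars ℝ).comp
        ((ContinuousMultilinearMap.apply ℝ (fun _ : Fin k => E n) (Form n i)
          (fun j => ek (w j))).comp (fderiv ℝ (iteratedFDeriv ℝ k f) y))) y := by
    intro k w y
    have hk : DifferentiableAt ℝ (iteratedFDeriv ℝ k f) y :=
      (hf.1.differentiable_iteratedFDeriv (m := k) (WithTop.coe_lt_coe.2 (ENat.natCast_lt_top k))) y
    have h1 := (ContinuousMultilinearMap.apply ℝ (fun _ : Fin k => E n) (Form n i)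
      (fun j => ek (w j))).hasFDerivAt.comp y hk.hasFDerivAt
    exact ((a k w).restrictScalars ℝ).hasFDerivAt.comp y h1
  have hT : T f = fun y => ∑ k ∈ Finset.range (N + 1), ∑ w : Fin k → Fin n,
        a k w (iteratedFDeriv ℝ k f y (fun j => ek (w j))) := funext (ha f hf)
  change pd j (T f) x = _
  rw [Finset.sum_range_succ']
  simp only [zero_apply, Finset.sum_const_zero, add_zero]
  simp only [hT, pd]
  rw [fderiv_fun_sum fun k _ => DifferentiableAt.fun_sum fun w _ => (hdiff k w x).differentiableAt,
    sum_apply]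
  refine Finset.sum_congr rfl fun k _ => ?_
  rw [fderiv_fun_sum fun w _ => (hdiff k w x).differentiableAt, sum_apply,
    ← (Fin.consEquiv (fun _ : Fin (k + 1) => Fin n)).sum_comp, Fintype.sum_prod_type,
    Finset.sum_eq_single j]
  · refine Finset.sum_congr rfl fun w _ => ?_
    rw [(hdiff k w x).fderiv]
    simp [Fin.consEquiv, iteratedFDeriv_succ_apply_left]
    rfl
  · intro b _ hb
    simp [Fin.consEquiv, hb]
  · simp

theorem lap_iterate (m : ℕ) : IsConstCoeffOperator (fun f : E n → Form n i => lap^[m] f) := by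
  induction m with
  | zero => exact id
  | succ m ih =>
    exact (sum Finset.univ fun j => (ih.pd_comp j).pd_comp j).congr fun f _ => by
      rw [Function.iterate_succ_apply']; rfl

end IsConstCoeffOperator

end ConstantCoefficients

/-! ### The continued operator as a sum of scalar pairings -/

section Kernel

variable {n i : ℕ}

theorem kernel_apply {y : E n} (hy : y ≠ 0) (lam : ℂ) (v : Form n i) :
    kernel n i lam y v = (Complex.Gamma ((2 * lam - n) / 2))⁻¹ • ∑ j, ∑ k,
      reflCoeff j k (((‖y‖ : ℝ) : ℂ) ^ (2 * lam - n - n - 2) • ((y j * y k : ℝ) : ℂ) • v) := by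
  have hy' : (‖y‖ : ℂ) ≠ 0 := by simpa using hy
  rw [kernel, LinearMap.smul_apply, sigma_psi_apply hy, mul_smul]
  simp only [map_smul, ← Finset.smul_sum]
  congr 1
  · congr 2; ring
  · rw [smul_smul]
    congr 1
    rw [show 2 * lam - n - n - 2 = 2 * (lam - n) - (2 : ℕ) by push_cast; ring,
      Complex.cpow_sub _ _ hy', Complex.cpow_natCast, div_eq_mul_inv]

theorem integrable_kernel (hn : 1 ≤ n) (lam : ℂ) {F : E n → Form n i}
    (hF : ∀ j k, Integrable fun y => ((‖y‖ : ℝ) : ℂ) ^ (2 * lam - n - n - 2) • mulCoord j k F y) :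
    Integrable fun y => kernel n i lam y (F y) := by
  have h : Integrable fun y => (Complex.Gamma ((2 * lam - n) / 2))⁻¹ • ∑ j, ∑ k,
      reflCoeff j k (((‖y‖ : ℝ) : ℂ) ^ (2 * lam - n - n - 2) • mulCoord j k F y) :=
    (integrable_finsetSum _ fun j _ => integrable_finsetSum _ fun k _ =>
      (reflCoeff j k).integrable_comp (hF j k)).smul ((Complex.Gamma ((2 * lam - n) / 2))⁻¹)
  refine h.congr ?_
  filter_upwards [ae_ne_zero hn] with y hy
  rw [kernel_apply hy]
  rfl

theorem integral_kernel (hn : 1 ≤ n) (lam : ℂ) {F : E n → Form n i}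
    (hF : ∀ j k, Integrable fun y => ((‖y‖ : ℝ) : ℂ) ^ (2 * lam - n - n - 2) • mulCoord j k F y) :
    ∫ y, kernel n i lam y (F y) = ∑ j, ∑ k, reflCoeff j k
      ((Complex.Gamma ((2 * lam - n) / 2))⁻¹ •
        normPowIntegral (2 * lam - n - n - 2) (mulCoord j k F)) := by
  have h1 : ∫ y, kernel n i lam y (F y) =
      ∫ y, (Complex.Gamma ((2 * lam - n) / 2))⁻¹ • ∑ j, ∑ k,
      reflCoeff j k (((‖y‖ : ℝ) : ℂ) ^ (2 * lam - n - n - 2) • mulCoord j k F y) := by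
    refine integral_congr_ae ?_
    filter_upwards [ae_ne_zero hn] with y hy
    rw [kernel_apply hy]
    rfl
  have h2 : ∀ j k, Integrable fun y => reflCoeff j k
      (((‖y‖ : ℝ) : ℂ) ^ (2 * lam - n - n - 2) • mulCoord j k F y) := fun j k =>
    (reflCoeff j k).integrable_comp (hF j k)
  rw [h1, integral_smul, integral_finsetSum _ fun j _ => integrable_finsetSum _ fun k _ => h2 j k,
    Finset.smul_sum]
  refine Finset.sum_congr rfl fun j _ => ?_
  rw [integral_finsetSum _ fun k _ => h2 j k, Finset.smul_sum]
  refine Finset.sum_congr rfl fun k _ => ?_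
  rw [(reflCoeff j k).integral_comp_comm (hF j k), map_smul]
  rfl

theorem mem_convHalfPlane {lam : ℂ} : lam ∈ convHalfPlane n ↔ 0 < (2 * lam - n).re := by
  simp only [convHalfPlane, mem_ofPred_eq, Complex.sub_re, Complex.mul_re, Complex.re_ofNat,
    Complex.im_ofNat, zero_mul, sub_zero, Complex.natCast_re]
  constructor <;> intro h <;> linarith

theorem locallyIntegrable_kernel (hn : 1 ≤ n) {lam : ℂ} (hlam : lam ∈ convHalfPlane n)
    (v : Form n i) : LocallyIntegrable (fun x => kernel n i lam x v) := by
  have hz := mem_convHalfPlane.1 hlam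
  intro x
  have h : ∀ j k : Fin n, IntegrableAtFilter (fun y : E n =>
      reflCoeff j k (((‖y‖ : ℝ) : ℂ) ^ (2 * lam - n - n - 2) • ((y j * y k : ℝ) : ℂ) • v))
      (nhds x) := by
    intro j k
    obtain ⟨s, hs, hi⟩ := locallyIntegrable_norm_cpow_mul_coord hn j k hz x
    refine ⟨s, hs, ?_⟩
    have := (reflCoeff j k).integrable_comp (hi.smul_const v)
    simp only [smul_smul]
    exact this
  choose s hs hi using h
  refine ⟨⋂ j, ⋂ k, s j k, Filter.iInter_mem.2 fun j => Filter.iInter_mem.2 fun k => hs j k, ?_⟩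
  have hsub : ∀ j k, ⋂ j, ⋂ k, s j k ⊆ s j k := fun j k =>
    (iInter_subset (fun j => ⋂ k, s j k) j).trans (iInter_subset (s j) k)
  have hint : ∀ j k : Fin n, Integrable (fun y : E n =>
      reflCoeff j k (((‖y‖ : ℝ) : ℂ) ^ (2 * lam - n - n - 2) • ((y j * y k : ℝ) : ℂ) • v))
      (volume.restrict (⋂ j, ⋂ k, s j k)) := fun j k => (hi j k).mono_set (hsub j k)
  have hsum : Integrable (fun y : E n => (Complex.Gamma ((2 * lam - n) / 2))⁻¹ • ∑ j, ∑ k,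
      reflCoeff j k (((‖y‖ : ℝ) : ℂ) ^ (2 * lam - n - n - 2) • ((y j * y k : ℝ) : ℂ) • v))
      (volume.restrict (⋂ j, ⋂ k, s j k)) :=
    (integrable_finsetSum _ fun j _ => integrable_finsetSum _ fun k _ => hint j k).smul
      ((Complex.Gamma ((2 * lam - n) / 2))⁻¹)
  refine Integrable.congr hsum ?_
  filter_upwards [ae_restrict_of_ae (ae_ne_zero hn)] with y hy
  exact (kernel_apply hy lam v).symm

theorem integrable_mulCoord_reflTranslate (hn : 1 ≤ n) {lam : ℂ} (hlam : lam ∈ convHalfPlane n)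
    {f : E n → Form n i} (hf : IsTestForm f) (x : E n) (j k : Fin n) :
    Integrable fun y => ((‖y‖ : ℝ) : ℂ) ^ (2 * lam - n - n - 2) •
      mulCoord j k (reflTranslate hf.1 hf.2 x) y := by
  refine integrable_cpow_mulCoord hn ?_ j k _
  have := mem_convHalfPlane.1 hlam
  simp only [Complex.sub_re, Complex.natCast_re, Complex.re_ofNat] at this ⊢
  linarith

theorem convKernel_eq_sum (hn : 1 ≤ n) {lam : ℂ} (hlam : lam ∈ convHalfPlane n)
    {f : E n → Form n i} (hf : IsTestForm f) (x : E n) :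
    convKernel n i lam f x =
      ∑ j, ∑ k, reflCoeff j k (rieszPairing j k (reflTranslate hf.1 hf.2 x) (2 * lam - n)) := by
  have hz := mem_convHalfPlane.1 hlam
  simp only [convKernel, rieszPairing_of_pos _ _ _ hz]
  rw [← integral_sub_left_eq_self _ volume x]
  simp only [sub_sub_cancel]
  exact integral_kernel hn lam (F := reflTranslate hf.1 hf.2 x)
    (integrable_mulCoord_reflTranslate hn hlam hf x)

theorem differentiable_sum_reflCoeff_rieszPairing (hn : 1 ≤ n)
    (F : SchwartzMap (E n) (Form n i)) : Differentiable ℂ fun lam : ℂ =>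
      ∑ j, ∑ k, reflCoeff j k (rieszPairing j k F (2 * lam - n)) :=
  Differentiable.fun_sum fun j _ => Differentiable.fun_sum fun k _ =>
    (reflCoeff j k).differentiable.comp ((differentiable_rieszPairing hn j k F).comp
      ((differentiable_id.const_mul 2).sub_const _))

/-- The continued operator, written through the pairings `rieszPairing`. -/
theorem knappStein_eq_sum (hn : 1 ≤ n) {f : E n → Form n i} (hf : IsTestForm f) (x : E n)
    (lam : ℂ) : knappStein n i lam f x =
      ∑ j, ∑ k, reflCoeff j k (rieszPairing j k (reflTranslate hf.1 hf.2 x) (2 * lam - n)) := by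
  have hopen : IsOpen (convHalfPlane n) := isOpen_lt continuous_const Complex.continuous_re
  have hne : (convHalfPlane n).Nonempty := ⟨((n : ℝ) : ℂ), by
    have : (0 : ℝ) < n := by exact_mod_cast hn
    simp only [convHalfPlane, mem_ofPred_eq, Complex.ofReal_re]
    linarith⟩
  exact congrFun (entireContinuation_eq hopen hne
    (differentiable_sum_reflCoeff_rieszPairing hn (reflTranslate hf.1 hf.2 x)) fun mu hmu =>
    (convKernel_eq_sum hn hmu hf x).symm) lam

end Kernel

/-! ### Regularity, and the values at `n - 2λ ∈ 2ℕ` -/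

section Operator

variable {n i : ℕ}

theorem integrable_kernel_sub (hn : 1 ≤ n) {lam : ℂ} (hlam : lam ∈ convHalfPlane n)
    {f : E n → Form n i} (hf : IsTestForm f) (x : E n) :
    Integrable fun y => kernel n i lam (x - y) (f y) := by
  have h := (integrable_kernel hn lam (F := reflTranslate hf.1 hf.2 x)
    (integrable_mulCoord_reflTranslate hn hlam hf x)).comp_sub_left x
  simpa only [reflTranslate_apply, sub_sub_cancel] using h

theorem knappStein_eq_convKernel (hn : 1 ≤ n) {lam : ℂ} (hlam : lam ∈ convHalfPlane n)
    {f : E n → Form n i} (hf : IsTestForm f) (x : E n) :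
    knappStein n i lam f x = convKernel n i lam f x := by
  rw [knappStein_eq_sum hn hf, convKernel_eq_sum hn hlam hf]

theorem differentiable_knappStein (hn : 1 ≤ n) {f : E n → Form n i} (hf : IsTestForm f)
    (x : E n) : Differentiable ℂ fun lam => knappStein n i lam f x := by
  simp only [knappStein_eq_sum hn hf x]
  exact differentiable_sum_reflCoeff_rieszPairing hn _

theorem contDiff_knappStein (hn : 1 ≤ n) {f : E n → Form n i} (hf : IsTestForm f) (lam : ℂ) :
    ContDiff ℝ ∞ (knappStein n i lam f) := by
  rw [show knappStein n i lam f = _ from funext fun x => knappStein_eq_sum hn hf x lam]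
  exact ContDiff.sum fun j _ => ContDiff.sum fun k _ =>
    ((reflCoeff j k).restrictScalars ℝ).contDiff.comp
      (contDiff_rieszPairing_reflTranslate hn j k hf.1 hf.2 _)

/-- The residue formula. The trace of `δ_jk - 2 e_j ∧ ι_k` against `δ_jk / 2` is `n/2 - i`, the
constant in Branson's operator. -/
theorem knappStein_half_sub (hn : 1 ≤ n) (m : ℕ) {f : E n → Form n i} (hf : IsTestForm f) :
    knappStein n i ((n : ℂ) / 2 - (m + 1 : ℕ)) f =
      (((-1) ^ (m + 1 + 1) * Real.pi ^ ((n : ℝ) / 2) /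
        (2 ^ (2 * (m + 1)) * Real.Gamma ((n : ℝ) / 2 + (m + 1 : ℕ) + 1)) : ℝ) : ℂ) •
        branson (m + 1) f := by
  funext x
  rw [knappStein_eq_sum hn hf, Pi.smul_apply,
    show 2 * ((n : ℂ) / 2 - (m + 1 : ℕ)) - n = -(2 * (m + 1 : ℕ)) by ring]
  simp only [rieszPairing_neg_even hn _ _ hf.1 hf.2, map_smul, ← Finset.smul_sum]
  rw [pow_succ _ (m + 1), mul_neg_one, neg_mul, neg_div, Complex.ofReal_neg, neg_smul, ← smul_neg,
    branson_succ_apply hf.1]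
  congr 1
  have h1 : ∀ j k : Fin n, reflCoeff j k
      (((if j = k then (1 : ℂ) else 0) / 2) • lap^[m + 1] f x +
        ((m + 1 : ℕ) : ℂ) • pd j (pd k (lap^[m] f)) x) =
      (if j = k then ((1 / 2 : ℂ) • lap^[m + 1] f x +
        ((m + 1 : ℕ) : ℂ) • pd j (pd j (lap^[m] f)) x - wedgeContr j j (lap^[m + 1] f x)) else 0) -
        (2 * (m + 1 : ℕ) : ℂ) • wedgeContr j k (pd j (pd k (lap^[m] f)) x) := by
    intro j k
    rw [reflCoeff_apply]
    split_ifs with h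
    · subst h
      rw [map_add, map_smul, map_smul]
      module
    · rw [map_add, map_smul, map_smul]
      module
  simp only [h1, Finset.sum_sub_distrib, Finset.sum_add_distrib, Finset.sum_ite_eq, Finset.mem_univ,
    if_true, sum_wedgeContr_self, Finset.sum_const, Finset.card_univ, Fintype.card_fin,
    ← Finset.smul_sum, ← Nat.cast_smul_eq_nsmul ℂ]
  have h2 : ∑ j, pd j (pd j (lap^[m] f)) x = lap^[m + 1] f x := by
    rw [Function.iterate_succ_apply']; rfl
  rw [h2]
  module

/-- At the points `n - 2λ ∈ 2ℕ` the operator has constant coefficients. -/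
theorem isConstCoeffOperator_knappStein (hn : 1 ≤ n) {lam : ℂ} {m : ℕ}
    (hm : (n : ℂ) - 2 * lam = 2 * m) : IsConstCoeffOperator (knappStein n i lam) := by
  have hz : 2 * lam - n = -(2 * m) := by linear_combination -hm
  cases m with
  | zero =>
    refine (IsConstCoeffOperator.sum Finset.univ fun j : Fin n => IsConstCoeffOperator.sum
      Finset.univ fun k : Fin n => IsConstCoeffOperator.id.comp_left
        ((symbolFactor n 0 * ((if j = k then (1 : ℂ) else 0) / 2)) • reflCoeff j k)).congr
      fun f hf => funext fun x => ?_
    rw [knappStein_eq_sum hn hf, hz]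
    simp only [Nat.cast_zero, mul_zero, neg_zero, rieszPairing_zero hn _ _ hf.1 hf.2, map_smul]
    rfl
  | succ m =>
    refine (IsConstCoeffOperator.sum Finset.univ fun j : Fin n => IsConstCoeffOperator.sum
      Finset.univ fun k : Fin n =>
        (((IsConstCoeffOperator.lap_iterate (m + 1)).comp_left
          ((((if j = k then (1 : ℂ) else 0) / 2)) • ContinuousLinearMap.id ℂ _)).add
        ((((IsConstCoeffOperator.lap_iterate m).pd_comp k).pd_comp j).comp_left
          (((m + 1 : ℕ) : ℂ) • ContinuousLinearMap.id ℂ _))).comp_left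
        ((((-1) ^ (m + 1) * Real.pi ^ ((n : ℝ) / 2) /
          (2 ^ (2 * (m + 1)) * Real.Gamma ((n : ℝ) / 2 + (m + 1 : ℕ) + 1)) : ℝ) : ℂ) •
          reflCoeff j k)).congr
      fun f hf => funext fun x => ?_
    rw [knappStein_eq_sum hn hf, hz]
    simp only [rieszPairing_neg_even hn _ _ hf.1 hf.2, map_smul]
    rfl

end Operator

/-! ### Nonlocality for `n - 2λ ∉ 2ℕ` -/

section Nonlocality

variable {n i : ℕ}

/-- For `i ≤ n` the space `⋀ⁱ(ℂⁿ)` is not zero: it contains the minor `dx₁ ∧ ⋯ ∧ dxᵢ`. -/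
theorem exists_form_ne_zero (hi : i ≤ n) : ∃ v : Form n i, v ≠ 0 := by
  let A : E n [⋀^Fin i]→ₗ[ℝ] ℂ := Complex.ofRealCLM.toLinearMap.compAlternatingMap
    ((Matrix.detRowAlternating (R := ℝ) (n := Fin i)).compLinearMap
      (LinearMap.pi fun p : Fin i => (EuclideanSpace.proj (𝕜 := ℝ) (Fin.castLE hi p) :
        E n →L[ℝ] ℝ).toLinearMap))
  have hA : ∀ w : Fin i → E n, A w =
      ((Matrix.of fun p q : Fin i => w p (Fin.castLE hi q)).det : ℝ) := fun w => rfl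
  let v : Form n i := { A with
    cont := by
      change Continuous fun w => A w
      simp only [hA]
      exact Complex.continuous_ofReal.comp (Continuous.matrix_det (by fun_prop)) }
  refine ⟨v, fun h => ?_⟩
  have h1 : A (fun p => ek (Fin.castLE hi p)) = 0 :=
    congrArg (fun u : Form n i => u fun p => ek (Fin.castLE hi p)) h
  rw [hA] at h1
  have h2 : (Matrix.of fun p q : Fin i => (ek (Fin.castLE hi p) : E n) (Fin.castLE hi q)) = 1 := by
    ext p q
    simp [Matrix.one_apply, eq_comm]
  rw [h2] at h1
  simp at h1

theorem kernel_apply_ne_zero {lam : ℂ} (hlam : ∀ m : ℕ, (n : ℂ) - 2 * lam ≠ 2 * m) {y : E n}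
    (hy : y ≠ 0) {v : Form n i} (hv : v ≠ 0) : kernel n i lam y v ≠ 0 := by
  have hy' : (‖y‖ : ℂ) ≠ 0 := by simpa using hy
  rw [kernel, LinearMap.smul_apply]
  refine smul_ne_zero (mul_ne_zero (inv_ne_zero fun h => ?_) ?_) fun h => hv ?_
  · obtain ⟨m, hm⟩ := (Complex.Gamma_eq_zero_iff _).1 h
    exact hlam m (by linear_combination -2 * hm)
  · simp [Complex.cpow_eq_zero_iff, hy]
  · ext w
    have h1 : sigma i (psi y) v (fun p => psi y (w p)) = 0 := by rw [h]; rfl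
    change v (fun p => (psi y).symm (psi y (w p))) = 0 at h1
    simpa using h1

theorem continuousOn_kernel (lam : ℂ) (v : Form n i) :
    ContinuousOn (fun y => kernel n i lam y v) {0}ᶜ := by
  refine ContinuousOn.congr (f := fun y : E n => (Complex.Gamma ((2 * lam - n) / 2))⁻¹ • ∑ j, ∑ k,
      reflCoeff j k (((‖y‖ : ℝ) : ℂ) ^ (2 * lam - n - n - 2) • ((y j * y k : ℝ) : ℂ) • v)) ?_
    fun y hy => kernel_apply hy lam v
  have hw : ContinuousOn (fun y : E n => ((‖y‖ : ℝ) : ℂ) ^ (2 * lam - n - n - 2)) {0}ᶜ :=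
    fun y hy => (continuousAt_norm_cpow hy _).continuousWithinAt
  have hterm : ∀ j k : Fin n, ContinuousOn (fun y : E n => reflCoeff j k
      (((‖y‖ : ℝ) : ℂ) ^ (2 * lam - n - n - 2) • ((y j * y k : ℝ) : ℂ) • v)) {0}ᶜ := fun j k =>
    (reflCoeff j k).continuous.comp_continuousOn
      (hw.smul (Continuous.continuousOn (by fun_prop)))
  exact ContinuousOn.fun_const_smul (continuousOn_finsetSum _ fun j _ =>
    continuousOn_finsetSum _ fun k _ => hterm j k) _

/-- At points outside the support of `f` the continued operator is still the convolution. -/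
theorem knappStein_of_eventually_zero (hn : 1 ≤ n) (lam : ℂ) {f : E n → Form n i}
    (hf : IsTestForm f) {x : E n} (h0 : ∀ᶠ y in nhds x, f y = 0) :
    knappStein n i lam f x = ∫ y, kernel n i lam y (f (x - y)) := by
  have hc := hasCompactSupport_reflTranslate hf.1 hf.2 x
  have h0' : ∀ᶠ y in nhds 0, reflTranslate hf.1 hf.2 x y = 0 := by
    have : Filter.Tendsto (fun y => x - y) (nhds 0) (nhds x) :=
      Continuous.tendsto' (by fun_prop) 0 x (by simp)
    exact this.eventually h0
  rw [knappStein_eq_sum hn hf]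
  simp only [rieszPairing_of_eventually_zero hn _ _ _ hc h0']
  exact (integral_kernel hn lam (F := reflTranslate hf.1 hf.2 x) fun j k =>
    integrable_cpow_mulCoord_of_eventually_zero j k _ hc h0' _).symm

theorem IsDifferentialOperator.apply_eq_zero {T : (E n → Form n i) → (E n → Form n i)}
    (hT : IsDifferentialOperator T) {f : E n → Form n i} (hf : IsTestForm f) {x : E n}
    (h0 : ∀ᶠ y in nhds x, f y = 0) : T f x = 0 := by
  obtain ⟨N, a, -, ha⟩ := hT
  rw [ha f hf x]
  refine Finset.sum_eq_zero fun k _ => Finset.sum_eq_zero fun w _ => ?_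
  have h1 : f =ᶠ[nhds x] fun _ => 0 := h0
  rw [(h1.iteratedFDeriv ℝ k).eq_of_nhds]
  simp

/-- Off the points `n - 2λ ∈ 2ℕ` the operator is not local: its kernel vanishes nowhere. -/
theorem not_isDifferentialOperator_knappStein (hn : 1 ≤ n) (hi : i ≤ n) {lam : ℂ}
    (hlam : ∀ m : ℕ, (n : ℂ) - 2 * lam ≠ 2 * m) :
    ¬ IsDifferentialOperator (knappStein n i lam) := by
  intro hT
  obtain ⟨v, hv⟩ := exists_form_ne_zero hi
  have hae := isOpen_compl_singleton.ae_eq_zero_of_integral_contDiff_smul_eq_zero (μ := volume)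
    ((continuousOn_kernel lam v).locallyIntegrableOn (μ := volume)
      (measurableSet_singleton (0 : E n)).compl) fun g hg hgc hgs => by
    have hf : IsTestForm fun y => g (-y) • v :=
      ⟨(hg.comp contDiff_neg).smul contDiff_const,
        (hgc.comp_homeomorph (Homeomorph.neg (E n))).smul_right⟩
    have h0 : ∀ᶠ y in nhds (0 : E n), g (-y) • v = 0 := by
      have h1 : ∀ᶠ y in nhds (0 : E n), g y = 0 :=
        notMem_tsupport_iff_eventuallyEq.1 fun h => hgs h rfl
      have h2 : Filter.Tendsto (fun y : E n => -y) (nhds 0) (nhds 0) :=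
        Continuous.tendsto' (by fun_prop) 0 0 neg_zero
      filter_upwards [h2.eventually h1] with y hy
      rw [hy, zero_smul]
    have h3 := (knappStein_of_eventually_zero hn lam hf h0).symm.trans (hT.apply_eq_zero hf h0)
    simpa only [zero_sub, neg_neg, LinearMap.map_smul_of_tower] using h3
  obtain ⟨y, hy, hy0⟩ := (hae.and (ae_ne_zero hn)).exists
  exact kernel_apply_ne_zero hlam hy0 hv (hy hy0)

end Nonlocality

end KnappStein

end

theorem theorem4p1 (n i : ℕ) (hn : 1 ≤ n) (hi : i ≤ n) :
    -- the analytic continuation exists: for `Re λ > n/2` the kernel is locally integrable and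
    -- the operator is the convolution; it depends holomorphically on `λ ∈ ℂ`
    (∀ lam ∈ KnappStein.convHalfPlane n, ∀ v : KnappStein.Form n i,
      LocallyIntegrable (fun x => KnappStein.kernel n i lam x v)) ∧
    (∀ f : KnappStein.E n → KnappStein.Form n i, KnappStein.IsTestForm f →
      (∀ lam ∈ KnappStein.convHalfPlane n, ∀ x : KnappStein.E n,
        Integrable (fun y => KnappStein.kernel n i lam (x - y) (f y)) ∧
        KnappStein.knappStein n i lam f x = KnappStein.convKernel n i lam f x) ∧
      (∀ x : KnappStein.E n, Differentiable ℂ (fun lam => KnappStein.knappStein n i lam f x)) ∧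
      (∀ lam : ℂ, ContDiff ℝ ∞ (KnappStein.knappStein n i lam f))) ∧
    -- when it is a differential operator
    (∀ lam : ℂ, KnappStein.IsDifferentialOperator (KnappStein.knappStein n i lam) ↔
      ∃ m : ℕ, (n : ℂ) - 2 * lam = 2 * m) ∧
    -- the residue formula
    (∀ l : ℕ, 1 ≤ l → ∀ f : KnappStein.E n → KnappStein.Form n i, KnappStein.IsTestForm f →
      KnappStein.knappStein n i ((n : ℂ) / 2 - l) f =
        (((-1) ^ (l + 1) * Real.pi ^ ((n : ℝ) / 2) /
          (2 ^ (2 * l) * Real.Gamma ((n : ℝ) / 2 + l + 1)) : ℝ) : ℂ) •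
          KnappStein.branson l f) := by
  refine ⟨fun lam hlam v => KnappStein.locallyIntegrable_kernel hn hlam v, fun f hf =>
    ⟨fun lam hlam x => ⟨KnappStein.integrable_kernel_sub hn hlam hf x,
      KnappStein.knappStein_eq_convKernel hn hlam hf x⟩,
      fun x => KnappStein.differentiable_knappStein hn hf x,
      fun lam => KnappStein.contDiff_knappStein hn hf lam⟩, fun lam => ⟨fun h => ?_, ?_⟩,
    fun l hl f hf => ?_⟩
  · by_contra! hlam
    exact KnappStein.not_isDifferentialOperator_knappStein hn hi hlam h
  · rintro ⟨m, hm⟩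
    exact (KnappStein.isConstCoeffOperator_knappStein hn hm).isDifferentialOperator
  · obtain ⟨m, rfl⟩ := Nat.exists_eq_add_of_le' hl
    exact KnappStein.knappStein_half_sub hn m hf
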